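/- Conventions. Graphs are finite, simple, undirected and connected; a graph is cubic if every vertex has exactly three neighbours. An $s$-arc of $X$ is a sequence $(u_0,\dots,u_s)$ of vertices with $u_i$ adjacent to $u_{i+1}$ for $0\le i<s$ and $u_i\ne u_{i+2}$ for $0\le i\le s-2$. $X$ is symmetric if $\mathrm{Aut}(X)$ is transitive on ordered pairs of adjacent vertices. A subgroup $K\le\mathrm{Aut}(X)$ is $s$-regular if it is transitive on the $s$-arcs of $X$ and only the identity of $K$ fixes an $s$-arc; $X$ is $s$-regular if $\mathrm{Aut}(X)$ is. An odd automorphism is an automorphism that is an odd permutation of the vertex set $V(X)$. Consider the groups $$G_2^1=\langle h,a,p\mid h^3=a^2=p^2=1,\ apa=p,\ php=h^{-1}\rangle,\qquad G_2^2=\langle h,a,p\mid h^3=p^2=1,\ a^2=p,\ php=h^{-1}\rangle,$$ $$G_4^1=\langle h,a,p,q,r\mid h^3=a^2=p^2=q^2=r^2=1,\ apa=p,\ aqa=r,\ \mathcal R\rangle,$$ $$G_4^2=\langle h,a,p,q,r\mid h^3=p^2=q^2=r^2=1,\ a^2=p,\ a^{-1}qa=r,\ \mathcal R\rangle,$$ where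 $\mathcal R$ stands for $h^{-1}ph=q,\ h^{-1}qh=pq,\ rhr=h^{-1},\ pq=qp,\ pr=rp,\ rq=pqr$. For $s\in\{2,4\}$ and $i\in\{1,2\}$, an $s$-regular subgroup $K\le\mathrm{Aut}(X)$ of a cubic symmetric graph $X$ is of class $s^i$ if there is an epimorphism $G_s^i\to K$ that, for some pair of adjacent vertices $v,w$, maps the subgroup generated by all the listed generators other than $a$ onto the stabilizer $K_v$, and maps $a$ to an element interchanging $v$ and $w$. For $s\in\{1,3,5\}$, $K$ is of class $s$ if it is $s$-regular. A cubic symmetric graph $X$ with $s$-regular automorphism group is of type $T$ if $T$ is the set of those classes among $1,2^1,2^2,3,4^1,4^2,5$ that occur among the subgroups of $\mathrm{Aut}(X)$ (the largest number occurring in $T$ being $s$). **Proposition 4.9.** Let $X$ be a cubic symmetric graph of order $2n$. (a) If $X$ is $5$-regular and $\mathrm{Aut}(X)$ has a $4$-regular subgroup $K$, then $X$ has an odd automorphism if and only if $X$ is bipartite and $n$ is odd. (b) If $X$ is of type $\{4^1,5\}$ or of type $\{4^2,5\}$ (so that $\mathrm{Aut}(X)$ is $5$-regular), then $X$ has no odd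 automorphism. -/

import Mathlib

namespace CubicSymmetric

variable {V : Type*}

/-- An `s`-arc of `X`: vertices `u 0, …, u s`, consecutive ones adjacent, and any three
consecutive ones pairwise distinct (the walk never turns straight back). -/
def IsSArc (X : SimpleGraph V) (s : ℕ) (u : Fin (s + 1) → V) : Prop :=
  (∀ i : Fin s, X.Adj (u i.castSucc) (u i.succ)) ∧
    ∀ i j : Fin (s + 1), (j : ℕ) = (i : ℕ) + 2 → u i ≠ u j

/-- The group `K` of automorphisms is transitive on the arcs (ordered pairs of adjacent
vertices) of `X`. -/
def IsArcTransitive (X : SimpleGraph V) (K : Subgroup (X ≃g X)) : Prop :=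
  ∀ u v u' v' : V, X.Adj u v → X.Adj u' v' → ∃ g ∈ K, g u = u' ∧ g v = v'

/-- The graph `X` is symmetric: its full automorphism group is arc-transitive. -/
def IsSymmetric (X : SimpleGraph V) : Prop := IsArcTransitive X ⊤

/-- The group `K` of automorphisms is `s`-regular: transitive on `s`-arcs, with trivial
stabilizers of `s`-arcs. -/
def IsSRegular (X : SimpleGraph V) (s : ℕ) (K : Subgroup (X ≃g X)) : Prop :=
  (∀ u w : Fin (s + 1) → V, IsSArc X s u → IsSArc X s w → ∃ g ∈ K, ∀ i, g (u i) = w i) ∧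
    ∀ u : Fin (s + 1) → V, IsSArc X s u → ∀ g ∈ K, (∀ i, g (u i) = u i) → g = 1

/-- Some automorphism of `X` is an odd permutation of the vertices. -/
def HasOddAutomorphism [Fintype V] [DecidableEq V] (X : SimpleGraph V) : Prop :=
  ∃ g : X ≃g X, Equiv.Perm.sign g.toEquiv = -1

/-- Generators of the universal groups for `2`-regular actions. -/
inductive Gen2
  | h | a | p

/-- Generators of the universal groups for `4`-regular actions. -/
inductive Gen4
  | h | a | p | q | r

section Presentations

open FreeGroup

/-- `⟨h, a, p ∣ h³ = a² = p² = 1, apa = p, php = h⁻¹⟩`. -/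
def relsTwoI : Set (FreeGroup Gen2) :=
  let h := of Gen2.h
  let a := of Gen2.a
  let p := of Gen2.p
  {h ^ 3, a ^ 2, p ^ 2, (a * p * a) * p⁻¹, (p * h * p) * (h⁻¹)⁻¹}

/-- `⟨h, a, p ∣ h³ = p² = 1, a² = p, php = h⁻¹⟩`. -/
def relsTwoII : Set (FreeGroup Gen2) :=
  let h := of Gen2.h
  let a := of Gen2.a
  let p := of Gen2.p
  {h ^ 3, p ^ 2, a ^ 2 * p⁻¹, (p * h * p) * (h⁻¹)⁻¹}

/-- `⟨h, a, p, q, r ∣ h³ = a² = p² = q² = r² = 1, apa = p, aqa = r, h⁻¹ph = q, h⁻¹qh = pq,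
rhr = h⁻¹, pq = qp, pr = rp, rq = pqr⟩`. -/
def relsFourI : Set (FreeGroup Gen4) :=
  let h := of Gen4.h
  let a := of Gen4.a
  let p := of Gen4.p
  let q := of Gen4.q
  let r := of Gen4.r
  {h ^ 3, a ^ 2, p ^ 2, q ^ 2, r ^ 2, (a * p * a) * p⁻¹, (a * q * a) * r⁻¹,
    (h⁻¹ * p * h) * q⁻¹, (h⁻¹ * q * h) * (p * q)⁻¹, (r * h * r) * (h⁻¹)⁻¹,
    (p * q) * (q * p)⁻¹, (p * r) * (r * p)⁻¹, (r * q) * (p * q * r)⁻¹}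

/-- `⟨h, a, p, q, r ∣ h³ = p² = q² = r² = 1, a² = p, a⁻¹qa = r, h⁻¹ph = q, h⁻¹qh = pq,
rhr = h⁻¹, pq = qp, pr = rp, rq = pqr⟩`. -/
def relsFourII : Set (FreeGroup Gen4) :=
  let h := of Gen4.h
  let a := of Gen4.a
  let p := of Gen4.p
  let q := of Gen4.q
  let r := of Gen4.r
  {h ^ 3, p ^ 2, q ^ 2, r ^ 2, a ^ 2 * p⁻¹, (a⁻¹ * q * a) * r⁻¹,
    (h⁻¹ * p * h) * q⁻¹, (h⁻¹ * q * h) * (p * q)⁻¹, (r * h * r) * (h⁻¹)⁻¹,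
    (p * q) * (q * p)⁻¹, (p * r) * (r * p)⁻¹, (r * q) * (p * q * r)⁻¹}

end Presentations

/-- The group `K` of automorphisms of `X` is, as a group acting on `X`, a quotient of the group
with generators `Gen` and relators `rels`: there is an epimorphism onto `K` under which the
generators in `S` generate the stabilizer of a vertex `v`, and the generator `a` interchanges
`v` with a neighbour. -/
def IsActionQuotient (X : SimpleGraph V) (K : Subgroup (X ≃g X)) {Gen : Type}
    (rels : Set (FreeGroup Gen)) (S : Set Gen) (a : Gen) : Prop :=
  ∃ φ : PresentedGroup rels →* K, Function.Surjective φ ∧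
    ∃ v w : V, X.Adj v w ∧
      (∀ g : K, g ∈ Subgroup.closure ((fun x => φ (PresentedGroup.of x)) '' S) ↔
        (g : X ≃g X) v = v) ∧
      (φ (PresentedGroup.of a) : X ≃g X) v = w ∧
      (φ (PresentedGroup.of a) : X ≃g X) w = v

/-- The seven classes `1`, `2¹`, `2²`, `3`, `4¹`, `4²`, `5` of arc-transitive groups of
automorphisms of cubic graphs. -/
inductive ArcClass
  | one | twoI | twoII | three | fourI | fourII | five

/-- The group `K` of automorphisms of the cubic graph `X` belongs to the given class. -/
def IsOfClass (X : SimpleGraph V) (K : Subgroup (X ≃g X)) : ArcClass → Prop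
  | .one => IsSRegular X 1 K
  | .twoI => IsSRegular X 2 K ∧ IsActionQuotient X K relsTwoI {.h, .p} .a
  | .twoII => IsSRegular X 2 K ∧ IsActionQuotient X K relsTwoII {.h, .p} .a
  | .three => IsSRegular X 3 K
  | .fourI => IsSRegular X 4 K ∧ IsActionQuotient X K relsFourI {.h, .p, .q, .r} .a
  | .fourII => IsSRegular X 4 K ∧ IsActionQuotient X K relsFourII {.h, .p, .q, .r} .a
  | .five => IsSRegular X 5 K

/-- The cubic symmetric graph `X` has an `s`-regular full automorphism group and is of type `T`:
`T` is the set of classes of the arc-transitive groups of automorphisms of `X`. -/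
structure IsOfType (X : SimpleGraph V) (s : ℕ) (T : Set ArcClass) : Prop where
  regular : IsSRegular X s ⊤
  mem_iff : ∀ c : ArcClass, c ∈ T ↔ ∃ K : Subgroup (X ≃g X), IsOfClass X K c

end CubicSymmetric

/-! Write z_v for `center v`, the unique nontrivial automorphism fixing every vertex within distance
2 of v. It is an involution, and the pointwise stabilizer of a 4-arc with middle v is {1, z_v}.
Hence a 4-regular subgroup K has index two, contains no z_v, and contains every product z_u z_v.

Every z_v is even (`sign_center`). Its fixed vertices split into balls of 10 vertices, one for each
u with z_u = z_v (`card_fixed`). The number m of such u has the parity of the number 3n of edges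
(`card_center_modEq`): arc and edge stabilizers are 2-groups, so counts reduce modulo 2 to their
fixed points. The sign of z_v is therefore (-1)^(n+5m) = 1. It follows that vertex stabilizers are
even (`map_eq_one_of_fix`), so an odd automorphism forces X to be bipartite, with the sign recording
whether the two parts are interchanged (`bipartite_of_map_ne_one`). In a bipartite X an involution
reversing an edge has no fixed vertex and has sign (-1)^n; this gives (a).

For (b), an odd automorphism makes the sign a second index-two character; together with K it yields
a third index-two subgroup, again 4-regular. It has the same vertex stabilizers as K, while a is
replaced by a z_v. Since p = z_v z_w (`p_eq_center_mul_center`) and (a z_v)² = z_w a² z_v, the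
exchange turns class 4¹ into 4² and back, so neither can occur alone. -/

namespace CubicSymmetric

variable {V : Type*} {X : SimpleGraph V}

/-! ### Automorphisms, stars, balls and transitivity on short arcs. -/

/-- `a, b, c, d, e, f` is a `5`-arc of `X`. -/
def Arc5 (X : SimpleGraph V) (a b c d e f : V) : Prop :=
  X.Adj a b ∧ X.Adj b c ∧ X.Adj c d ∧ X.Adj d e ∧ X.Adj e f ∧ a ≠ c ∧ b ≠ d ∧ c ≠ e ∧ d ≠ f

/-- `X` is cubic and its automorphism group is regular on `5`-arcs. -/
structure FiveArcRegular (X : SimpleGraph V) : Prop where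
  exists_other : ∀ v a, X.Adj v a →
    ∃ b c, X.Adj v b ∧ X.Adj v c ∧ b ≠ a ∧ c ≠ a ∧ b ≠ c
  eq_of_adj : ∀ {v a b c d}, X.Adj v a → X.Adj v b → X.Adj v c → X.Adj v d →
    a ≠ b → a ≠ c → b ≠ c → d = a ∨ d = b ∨ d = c
  exists_adj : ∀ v, ∃ a, X.Adj v a
  trans : ∀ {a b c d e f a' b' c' d' e' f'}, Arc5 X a b c d e f → Arc5 X a' b' c' d' e' f' →
    ∃ g : X ≃g X, g a = a' ∧ g b = b' ∧ g c = c' ∧ g d = d' ∧ g e = e' ∧ g f = f'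
  rigid : ∀ {a b c d e f}, Arc5 X a b c d e f → ∀ {g : X ≃g X}, g a = a → g b = b → g c = c →
    g d = d → g e = e → g f = f → g = 1

/-- The automorphism `g` fixes `v` and all its neighbours. -/
def FixesStar (g : X ≃g X) (v : V) : Prop := g v = v ∧ ∀ x, X.Adj v x → g x = x

/-- The automorphism `g` fixes all vertices at distance at most `2` from `v`. -/
def FixesBall (g : X ≃g X) (v : V) : Prop := g v = v ∧ ∀ x, X.Adj v x → FixesStar g x

theorem aut_mul_apply (g h : X ≃g X) (v : V) : (g * h) v = g (h v) := rfl

theorem aut_inv_apply_eq {g : X ≃g X} {u v : V} : g⁻¹ u = v ↔ u = g v := by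
  constructor
  · rintro rfl; exact (g.apply_symm_apply u).symm
  · rintro rfl; exact g.symm_apply_apply v

theorem aut_inv_apply_self (g : X ≃g X) (v : V) : g⁻¹ (g v) = v := g.symm_apply_apply v

theorem aut_apply_inv_self (g : X ≃g X) (v : V) : g (g⁻¹ v) = v := g.apply_symm_apply v

theorem aut_adj (g : X ≃g X) {u v : V} (h : X.Adj u v) : X.Adj (g u) (g v) := g.map_adj_iff.2 h

theorem aut_inj (g : X ≃g X) {u v : V} (h : g u = g v) : u = v := g.injective h

theorem FixesBall.star {g : X ≃g X} {v : V} (h : FixesBall g v) : FixesStar g v :=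
  ⟨h.1, fun x hx => (h.2 x hx).1⟩

theorem FixesStar.mul {g k : X ≃g X} {v : V} (hg : FixesStar g v) (hk : FixesStar k v) :
    FixesStar (g * k) v :=
  ⟨by rw [aut_mul_apply, hk.1, hg.1], fun x hx => by rw [aut_mul_apply, hk.2 x hx, hg.2 x hx]⟩

theorem FixesStar.inv {g : X ≃g X} {v : V} (hg : FixesStar g v) : FixesStar g⁻¹ v :=
  ⟨aut_inv_apply_eq.2 hg.1.symm, fun x hx => aut_inv_apply_eq.2 (hg.2 x hx).symm⟩

theorem FixesBall.inv {g : X ≃g X} {v : V} (hg : FixesBall g v) : FixesBall g⁻¹ v :=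
  ⟨aut_inv_apply_eq.2 hg.1.symm, fun x hx => (hg.2 x hx).inv⟩

theorem FixesStar.conj {g : X ≃g X} {v : V} (hg : FixesStar g v) (k : X ≃g X) :
    FixesStar (k * g * k⁻¹) (k v) := by
  refine ⟨by simp only [aut_mul_apply, aut_inv_apply_self, hg.1], fun x hx => ?_⟩
  have h1 : X.Adj v (k⁻¹ x) := by
    have := aut_adj k⁻¹ hx
    rwa [aut_inv_apply_self] at this
  simp only [aut_mul_apply, hg.2 _ h1, aut_apply_inv_self]

theorem FixesBall.conj {g : X ≃g X} {v : V} (hg : FixesBall g v) (k : X ≃g X) :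
    FixesBall (k * g * k⁻¹) (k v) := by
  refine ⟨by simp only [aut_mul_apply, aut_inv_apply_self, hg.1], fun x hx => ?_⟩
  have h1 : X.Adj v (k⁻¹ x) := by
    have := aut_adj k⁻¹ hx
    rwa [aut_inv_apply_self] at this
  have := (hg.2 _ h1).conj k
  rwa [aut_apply_inv_self] at this

namespace FiveArcRegular

variable (H : FiveArcRegular X)
include H

theorem exists_third {v a b : V} (ha : X.Adj v a) (hb : X.Adj v b) (hab : a ≠ b) :
    ∃ c, X.Adj v c ∧ c ≠ a ∧ c ≠ b ∧ ∀ d, X.Adj v d → d = a ∨ d = b ∨ d = c := by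
  obtain ⟨c, d, hc, hd, hca, hda, hcd⟩ := H.exists_other v a ha
  have h1 := fun e he => H.eq_of_adj (d := e) ha hc hd he hca.symm hda.symm hcd
  rcases h1 b hb with h | h | h
  · exact absurd h.symm hab
  · subst h; exact ⟨d, hd, hda, hcd.symm, h1⟩
  · subst h; exact ⟨c, hc, hca, hcd, fun e he => by rcases h1 e he with h | h | h <;> simp [h]⟩

theorem exists_ne {v a : V} (ha : X.Adj v a) : ∃ b, X.Adj v b ∧ b ≠ a := by
  obtain ⟨b, c, hb, _, hba, _⟩ := H.exists_other v a ha
  exact ⟨b, hb, hba⟩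

theorem fixesStar {g : X ≃g X} {v a b : V} (ha : X.Adj v a) (hb : X.Adj v b) (hab : a ≠ b)
    (hv : g v = v) (hga : g a = a) (hgb : g b = b) : FixesStar g v := by
  refine ⟨hv, fun x hx => ?_⟩
  by_contra hne
  have hxa : x ≠ a := by rintro rfl; exact hne hga
  have hxb : x ≠ b := by rintro rfl; exact hne hgb
  have hgx : X.Adj v (g x) := by have := aut_adj g hx; rwa [hv] at this
  rcases H.eq_of_adj ha hb hx hgx hab hxa.symm hxb.symm with h | h | h
  · exact hxa (aut_inj g (h.trans hga.symm))
  · exact hxb (aut_inj g (h.trans hgb.symm))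
  · exact hne h

/-- Two automorphisms fixing `v` and its neighbour `a` and both moving its neighbour `b` agree
on the neighbours of `v`. -/
theorem fixesStar_mul {g k : X ≃g X} {v a b : V} (ha : X.Adj v a) (hb : X.Adj v b)
    (hgv : g v = v) (hkv : k v = v) (hga : g a = a) (hka : k a = a) (hgb : g b ≠ b)
    (hkb : k b ≠ b) : FixesStar (g * k) v := by
  have hab : a ≠ b := by rintro rfl; exact hgb hga
  obtain ⟨c, hc, hca, hcb, hall⟩ := H.exists_third ha hb hab
  have key : ∀ f : X ≃g X, f v = v → f a = a → f b ≠ b → f b = c ∧ f c = b := by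
    intro f hv hfa hfb
    have h1 : X.Adj v (f b) := by have := aut_adj f hb; rwa [hv] at this
    have h2 : X.Adj v (f c) := by have := aut_adj f hc; rwa [hv] at this
    have hb' : f b = c := by
      rcases hall _ h1 with h | h | h
      · exact absurd (aut_inj f (h.trans hfa.symm)) hab.symm
      · exact absurd h hfb
      · exact h
    refine ⟨hb', ?_⟩
    rcases hall _ h2 with h | h | h
    · exact absurd (aut_inj f (h.trans hfa.symm)) hca
    · exact h
    · exact absurd (aut_inj f (h.trans hb'.symm)) hcb
  refine H.fixesStar ha hb hab ?_ ?_ ?_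
  · rw [aut_mul_apply, hkv, hgv]
  · rw [aut_mul_apply, hka, hga]
  · rw [aut_mul_apply, (key k hkv hka hkb).1, (key g hgv hga hgb).2]

theorem exists_arc_extension {b c d e : V} (hbc : X.Adj b c) (hcd : X.Adj c d) (hde : X.Adj d e)
    (h1 : b ≠ d) (h2 : c ≠ e) : ∃ a f, Arc5 X a b c d e f := by
  obtain ⟨a, ha, hac⟩ := H.exists_ne hbc
  obtain ⟨f, hf, hfd⟩ := H.exists_ne hde.symm
  exact ⟨a, f, ha.symm, hbc, hcd, hde, hf, hac, h1, h2, hfd.symm⟩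

theorem trans3 {a b c d a' b' c' d' : V} (hab : X.Adj a b) (hbc : X.Adj b c) (hcd : X.Adj c d)
    (h1 : a ≠ c) (h2 : b ≠ d) (hab' : X.Adj a' b') (hbc' : X.Adj b' c') (hcd' : X.Adj c' d')
    (h1' : a' ≠ c') (h2' : b' ≠ d') :
    ∃ g : X ≃g X, g a = a' ∧ g b = b' ∧ g c = c' ∧ g d = d' := by
  obtain ⟨x, y, h⟩ := H.exists_arc_extension hab hbc hcd h1 h2
  obtain ⟨x', y', h'⟩ := H.exists_arc_extension hab' hbc' hcd' h1' h2'
  obtain ⟨g, -, h1, h2, h3, h4, -⟩ := H.trans h h'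
  exact ⟨g, h1, h2, h3, h4⟩

theorem trans2 {a b c a' b' c' : V} (hab : X.Adj a b) (hbc : X.Adj b c) (h1 : a ≠ c)
    (hab' : X.Adj a' b') (hbc' : X.Adj b' c') (h1' : a' ≠ c') :
    ∃ g : X ≃g X, g a = a' ∧ g b = b' ∧ g c = c' := by
  obtain ⟨d, hd, hdb⟩ := H.exists_ne hbc.symm
  obtain ⟨d', hd', hdb'⟩ := H.exists_ne hbc'.symm
  obtain ⟨g, h1, h2, h3, -⟩ := H.trans3 hab hbc hd h1 hdb.symm hab' hbc' hd' h1' hdb'.symm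
  exact ⟨g, h1, h2, h3⟩

theorem trans1 {a b a' b' : V} (hab : X.Adj a b) (hab' : X.Adj a' b') :
    ∃ g : X ≃g X, g a = a' ∧ g b = b' := by
  obtain ⟨d, hd, hdb⟩ := H.exists_ne hab.symm
  obtain ⟨d', hd', hdb'⟩ := H.exists_ne hab'.symm
  obtain ⟨g, h1, h2, -⟩ := H.trans2 hab hd hdb.symm hab' hd' hdb'.symm
  exact ⟨g, h1, h2⟩

theorem trans0 (a a' : V) : ∃ g : X ≃g X, g a = a' := by
  obtain ⟨b, hb⟩ := H.exists_adj a
  obtain ⟨b', hb'⟩ := H.exists_adj a'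
  obtain ⟨g, h, -⟩ := H.trans1 hb hb'
  exact ⟨g, h⟩

/-! ### Stabilizers of 4-arcs and the center of a vertex. -/

/-- Some nontrivial automorphism fixes a given `4`-arc. -/
theorem exists_fix4 {a b c d e : V} (hab : X.Adj a b) (hbc : X.Adj b c) (hcd : X.Adj c d)
    (hde : X.Adj d e) (h1 : a ≠ c) (h2 : b ≠ d) (h3 : c ≠ e) :
    ∃ g : X ≃g X, g ≠ 1 ∧ g a = a ∧ g b = b ∧ g c = c ∧ g d = d ∧ g e = e := by
  obtain ⟨f, f', hf, hf', hfd, hfd', hff⟩ := H.exists_other e d hde.symm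
  obtain ⟨g, ha, hb, hc, hd, he, hgf⟩ := H.trans (a := a) (a' := a)
    ⟨hab, hbc, hcd, hde, hf, h1, h2, h3, hfd.symm⟩
    ⟨hab, hbc, hcd, hde, hf', h1, h2, h3, hfd'.symm⟩
  refine ⟨g, ?_, ha, hb, hc, hd, he⟩
  rintro rfl
  exact hff hgf

/-- A nontrivial automorphism fixing a `4`-arc moves the further neighbours of its end. -/
theorem move_of_fix4 {a b c d e f : V} (hab : X.Adj a b) (hbc : X.Adj b c) (hcd : X.Adj c d)
    (hde : X.Adj d e) (h1 : a ≠ c) (h2 : b ≠ d) (h3 : c ≠ e) (hef : X.Adj e f) (hfd : f ≠ d)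
    {g : X ≃g X} (hg : g ≠ 1)
    (ha : g a = a) (hb : g b = b) (hc : g c = c) (hd : g d = d) (he : g e = e) : g f ≠ f :=
  fun hf => hg (H.rigid ⟨hab, hbc, hcd, hde, hef, h1, h2, h3, hfd.symm⟩ ha hb hc hd he hf)

/-- Both automorphisms must swap the two further neighbours of the end, so their quotient fixes a
5-arc. The pointwise stabilizer of a 4-arc thus has order two. -/
theorem eq_of_fix4 {a b c d e : V} (hab : X.Adj a b) (hbc : X.Adj b c) (hcd : X.Adj c d)
    (hde : X.Adj d e) (h1 : a ≠ c) (h2 : b ≠ d) (h3 : c ≠ e) {g k : X ≃g X} (hg : g ≠ 1)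
    (hk : k ≠ 1) (ga : g a = a) (gb : g b = b) (gc : g c = c) (gd : g d = d) (ge : g e = e)
    (ka : k a = a) (kb : k b = b) (kc : k c = c) (kd : k d = d) (ke : k e = e) : g = k := by
  obtain ⟨f, hf, hfd⟩ := H.exists_ne hde.symm
  have hi : ∀ {v : V}, k v = v → k⁻¹ v = v := fun h => aut_inv_apply_eq.2 h.symm
  have h := H.fixesStar_mul hde.symm hf ge (hi ke) gd (hi kd)
    (H.move_of_fix4 hab hbc hcd hde h1 h2 h3 hf hfd hg ga gb gc gd ge)
    (H.move_of_fix4 hab hbc hcd hde h1 h2 h3 hf hfd (inv_ne_one.2 hk)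
      (hi ka) (hi kb) (hi kc) (hi kd) (hi ke))
  have : g * k⁻¹ = 1 := by
    refine H.rigid ⟨hab, hbc, hcd, hde, hf, h1, h2, h3, hfd.symm⟩ ?_ ?_ ?_ ?_ h.1 (h.2 f hf)
    · rw [aut_mul_apply, hi ka, ga]
    · rw [aut_mul_apply, hi kb, gb]
    · rw [aut_mul_apply, hi kc, gc]
    · rw [aut_mul_apply, hi kd, gd]
  exact mul_inv_eq_one.1 this

/-- Let g and k be the involutions of two 4-arcs that share v, w, y but leave v through different
neighbours x and x'. Both fix the stars of v and w and move all vertices beyond w's other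
neighbours, so g k fixes the ball around w. If g k = 1, then g fixes the stars of w, x and x', hence
the ball around v. -/
theorem exists_fixesBall (v : V) : ∃ g : X ≃g X, g ≠ 1 ∧ FixesBall g v := by
  suffices h : ∃ u, ∃ g : X ≃g X, g ≠ 1 ∧ FixesBall g u by
    obtain ⟨u, g, hg, hu⟩ := h
    obtain ⟨k, rfl⟩ := H.trans0 u v
    exact ⟨k * g * k⁻¹, by simpa [conj_eq_one_iff] using hg, hu.conj k⟩
  obtain ⟨w, hw⟩ := H.exists_adj v
  obtain ⟨x, x', hx, hx', hxw, hxw', hxx⟩ := H.exists_other v w hw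
  obtain ⟨y, y', hy, hy', hyv, hyv', hyy⟩ := H.exists_other w v hw.symm
  obtain ⟨x₂, hx₂, hx₂v⟩ := H.exists_ne hx.symm
  obtain ⟨x₃, hx₃, hx₃v⟩ := H.exists_ne hx'.symm
  obtain ⟨y₂, hy₂, hy₂w⟩ := H.exists_ne hy.symm
  obtain ⟨y₃, hy₃, hy₃w⟩ := H.exists_ne hy'.symm
  obtain ⟨g, hg, ga, gb, gc, gd, ge⟩ :=
    H.exists_fix4 hx₂.symm hx.symm hw hy hx₂v hxw hyv.symm
  obtain ⟨k, hk, ka, kb, kc, kd, ke⟩ :=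
    H.exists_fix4 hx₃.symm hx'.symm hw hy hx₃v hxw' hyv.symm
  have gv := H.fixesStar hw hx hxw.symm gc gd gb
  have kv := H.fixesStar hw hx' hxw'.symm kc kd kb
  have gw := H.fixesStar hw.symm hy hyv.symm gd gc ge
  have kw := H.fixesStar hw.symm hy hyv.symm kd kc ke
  have gx := H.fixesStar hx.symm hx₂ hx₂v.symm gb gc ga
  have kx := H.fixesStar hx'.symm hx₃ hx₃v.symm kb kc ka
  have gy : g y₂ ≠ y₂ := H.move_of_fix4 hx₂.symm hx.symm hw hy hx₂v hxw hyv.symm hy₂ hy₂w hg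
    ga gb gc gd ge
  have gy' : g y₃ ≠ y₃ := H.move_of_fix4 hx₂.symm hx.symm hw hy' hx₂v hxw hyv'.symm hy₃ hy₃w hg
    ga gb gc gd (gw.2 _ hy')
  have ky : k y₂ ≠ y₂ := H.move_of_fix4 hx₃.symm hx'.symm hw hy hx₃v hxw' hyv.symm hy₂ hy₂w hk
    ka kb kc kd ke
  have ky' : k y₃ ≠ y₃ := H.move_of_fix4 hx₃.symm hx'.symm hw hy' hx₃v hxw' hyv'.symm hy₃ hy₃w hk
    ka kb kc kd (kw.2 _ hy')
  by_cases hgk : g * k = 1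
  · refine ⟨v, g, hg, gc, fun t ht => ?_⟩
    rcases H.eq_of_adj hw hx hx' ht hxw.symm hxw'.symm hxx with rfl | rfl | rfl
    · exact gw
    · exact gx
    · rw [eq_inv_of_mul_eq_one_left hgk]
      exact kx.inv
  · refine ⟨w, g * k, hgk, (gw.mul kw).1, fun t ht => ?_⟩
    rcases H.eq_of_adj hw.symm hy hy' ht hyv.symm hyv'.symm hyy with rfl | rfl | rfl
    · exact gv.mul kv
    · exact H.fixesStar_mul hy.symm hy₂ ge ke gd kd gy ky
    · exact H.fixesStar_mul hy'.symm hy₃ (gw.2 _ hy') (kw.2 _ hy') gd kd gy' ky'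

/-- The nontrivial automorphism fixing all vertices at distance at most `2` from `v`. -/
noncomputable def center (v : V) : X ≃g X := (H.exists_fixesBall v).choose

theorem center_ne_one (v : V) : H.center v ≠ 1 := (H.exists_fixesBall v).choose_spec.1

theorem center_fixesBall (v : V) : FixesBall (H.center v) v := (H.exists_fixesBall v).choose_spec.2

theorem center_fixesStar {v w : V} (h : X.Adj v w) : FixesStar (H.center v) w :=
  (H.center_fixesBall v).2 w h

theorem center_self (v : V) : H.center v v = v := (H.center_fixesBall v).1

theorem center_adj {v w : V} (h : X.Adj v w) : H.center v w = w := (H.center_fixesStar h).1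

theorem center_adj_adj {v w x : V} (h : X.Adj v w) (h' : X.Adj w x) : H.center v x = x :=
  (H.center_fixesStar h).2 x h'

theorem eq_center_of_fix4 {a b c d e : V} (hab : X.Adj a b) (hbc : X.Adj b c) (hcd : X.Adj c d)
    (hde : X.Adj d e) (h1 : a ≠ c) (h2 : b ≠ d) (h3 : c ≠ e) {g : X ≃g X} (hg : g ≠ 1)
    (ga : g a = a) (gb : g b = b) (gc : g c = c) (gd : g d = d) (ge : g e = e) :
    g = H.center c :=
  H.eq_of_fix4 hab hbc hcd hde h1 h2 h3 hg (H.center_ne_one c) ga gb gc gd ge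
    (H.center_adj_adj hbc.symm hab.symm) (H.center_adj hbc.symm) (H.center_self c)
    (H.center_adj hcd) (H.center_adj_adj hcd hde)

theorem eq_center {g : X ≃g X} {v : V} (hg : g ≠ 1) (h : FixesBall g v) : g = H.center v := by
  obtain ⟨x, hx⟩ := H.exists_adj v
  obtain ⟨y, hy, hyx⟩ := H.exists_ne hx
  obtain ⟨x₂, hx₂, hxv⟩ := H.exists_ne hx.symm
  obtain ⟨y₂, hy₂, hyv⟩ := H.exists_ne hy.symm
  exact H.eq_center_of_fix4 hx₂.symm hx.symm hy hy₂ hxv hyx.symm hyv.symm hg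
    ((h.2 x hx).2 _ hx₂) (h.2 x hx).1 h.1 (h.2 y hy).1 ((h.2 y hy).2 _ hy₂)

/-- Uniqueness makes the center equivariant; this turns questions about commuting into questions
about which vertices are moved. -/
theorem conj_center (g : X ≃g X) (v : V) : g * H.center v * g⁻¹ = H.center (g v) :=
  H.eq_center (by simpa [conj_eq_one_iff] using H.center_ne_one v) ((H.center_fixesBall v).conj g)

theorem mul_center (g : X ≃g X) (v : V) : g * H.center v = H.center (g v) * g := by
  rw [← H.conj_center, inv_mul_cancel_right]

theorem center_inv (v : V) : (H.center v)⁻¹ = H.center v :=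
  H.eq_center (inv_ne_one.2 (H.center_ne_one v)) (H.center_fixesBall v).inv

theorem center_mul_self (v : V) : H.center v * H.center v = 1 := by
  nth_rw 1 [← H.center_inv v]; exact inv_mul_cancel _

theorem center_mul_cancel_left (v : V) (g : X ≃g X) : H.center v * (H.center v * g) = g := by
  rw [← mul_assoc, center_mul_self, one_mul]

/-- `center v` moves the vertices at distance `3` from `v`. -/
theorem center_move {v w x y : V} (hvw : X.Adj v w) (hwx : X.Adj w x) (hxy : X.Adj x y)
    (h1 : v ≠ x) (h2 : w ≠ y) : H.center v y ≠ y := by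
  obtain ⟨u, hu, huw⟩ := H.exists_ne hvw
  obtain ⟨t, ht, htv⟩ := H.exists_ne hu.symm
  exact H.move_of_fix4 ht.symm hu.symm hvw hwx htv huw h1 hxy h2.symm (H.center_ne_one v)
    (H.center_adj_adj hu ht) (H.center_adj hu) (H.center_self v) (H.center_adj hvw)
    (H.center_adj_adj hvw hwx)

theorem center_ne_of_adj {v w : V} (h : X.Adj v w) : H.center v ≠ H.center w := by
  obtain ⟨x, hx, hxv⟩ := H.exists_ne h.symm
  obtain ⟨y, hy, hyw⟩ := H.exists_ne hx.symm
  intro he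
  refine H.center_move h hx hy hxv.symm hyw.symm ?_
  rw [he]
  exact H.center_adj_adj hx hy

theorem center_ne_of_adj_adj {v w x : V} (h : X.Adj v w) (h' : X.Adj w x) (hne : v ≠ x) :
    H.center v ≠ H.center x := by
  obtain ⟨y, hy, hyw⟩ := H.exists_ne h'.symm
  intro he
  refine H.center_move h h' hy hne hyw.symm ?_
  rw [he]
  exact H.center_adj hy

/-! ### Pointwise stabilizers of stars, and involutions. -/

/-- If g fixes a vertex x₂ at distance 2 from v away from w, it fixes a 4-arc with middle v.
Otherwise `center w * g` does, because `center w` moves x₂ as well. The group obtained is a Klein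
four-group. -/
theorem eq_of_fixesStar_of_fixesStar {g : X ≃g X} {v w : V} (h : X.Adj v w) (hv : FixesStar g v)
    (hw : FixesStar g w) :
    g = 1 ∨ g = H.center v ∨ g = H.center w ∨ g = H.center v * H.center w := by
  obtain ⟨x, hx, hxw⟩ := H.exists_ne h
  obtain ⟨x₂, hx₂, hx₂v⟩ := H.exists_ne hx.symm
  obtain ⟨y, hy, hyv⟩ := H.exists_ne h.symm
  have key : ∀ k : X ≃g X, FixesStar k v → FixesStar k w → k x₂ = x₂ →
      k = 1 ∨ k = H.center v := by
    intro k kv kw hk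
    by_cases h1 : k = 1
    · exact Or.inl h1
    · exact Or.inr (H.eq_center_of_fix4 hx₂.symm hx.symm h hy hx₂v hxw hyv.symm h1 hk
        (kv.2 x hx) kv.1 kw.1 (kw.2 y hy))
  by_cases hgx : g x₂ = x₂
  · rcases key g hv hw hgx with h | h <;> simp [h]
  · have hs := H.fixesStar_mul hx.symm hx₂ (H.center_adj_adj h.symm hx) (hv.2 x hx)
      (H.center_adj h.symm) hv.1 (H.center_move h.symm hx hx₂ hxw.symm hx₂v.symm) hgx
    have hc : g = H.center w * (H.center w * g) := (H.center_mul_cancel_left w g).symm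
    have hcomm : H.center v * H.center w = H.center w * H.center v := by
      rw [H.mul_center, H.center_adj h]
    rcases key (H.center w * g) ((H.center_fixesStar h.symm).mul hv)
      ((H.center_fixesBall w).star.mul hw) (hs.2 _ hx₂) with h1 | h1
    · rw [h1, mul_one] at hc; simp [hc]
    · rw [h1, ← hcomm] at hc; simp [hc]

/-- If g fixes no star of a neighbour, it moves every vertex beyond the neighbours of v. For a
neighbour x, `center x` moves those beyond the other two neighbours, so `center x * g` fixes a 4-arc
with middle v. -/
theorem eq_of_fixesStar {g : X ≃g X} {v : V} (hv : FixesStar g v) :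
    g = 1 ∨ g = H.center v ∨
      ∃ x, X.Adj v x ∧ (g = H.center x ∨ g = H.center v * H.center x) := by
  by_cases h : ∃ w, X.Adj v w ∧ FixesStar g w
  · obtain ⟨w, hw, hgw⟩ := h
    rcases H.eq_of_fixesStar_of_fixesStar hw hv hgw with h | h | h | h
    · exact Or.inl h
    · exact Or.inr (Or.inl h)
    · exact Or.inr (Or.inr ⟨w, hw, Or.inl h⟩)
    · exact Or.inr (Or.inr ⟨w, hw, Or.inr h⟩)
  · push Not at h
    have hmove : ∀ w x, X.Adj v w → X.Adj w x → x ≠ v → g x ≠ x := fun w x hw hx hxv hgx =>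
      h w hw (H.fixesStar hw.symm hx hxv.symm (hv.2 w hw) hv.1 hgx)
    obtain ⟨x, hx⟩ := H.exists_adj v
    have hs : ∀ w, X.Adj v w → w ≠ x → FixesStar (H.center x * g) w := by
      intro w hw hwx
      obtain ⟨t, ht, htv⟩ := H.exists_ne hw.symm
      exact H.fixesStar_mul hw.symm ht (H.center_adj_adj hx.symm hw) (hv.2 w hw)
        (H.center_adj hx.symm) hv.1 (H.center_move hx.symm hw ht hwx.symm htv.symm)
        (hmove w t hw ht htv)
    obtain ⟨w, y, hw, hy, hwx, hyx, hwy⟩ := H.exists_other v x hx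
    obtain ⟨w₂, hw₂, hw₂v⟩ := H.exists_ne hw.symm
    obtain ⟨y₂, hy₂, hy₂v⟩ := H.exists_ne hy.symm
    have hc : g = H.center x * (H.center x * g) := (H.center_mul_cancel_left x g).symm
    refine Or.inr (Or.inr ⟨x, hx, ?_⟩)
    by_cases h1 : H.center x * g = 1
    · rw [h1, mul_one] at hc; exact Or.inl hc
    · rw [H.eq_center_of_fix4 hw₂.symm hw.symm hy hy₂ hw₂v hwy hy₂v.symm h1
        ((hs w hw hwx).2 _ hw₂) (hs w hw hwx).1
        ((H.center_fixesStar hx.symm).mul hv).1 (hs y hy hyx).1 ((hs y hy hyx).2 _ hy₂),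
        H.mul_center, H.center_adj hx.symm] at hc
      exact Or.inr hc

theorem center_comm {u v : V} (h : H.center u v = v) :
    H.center u * H.center v = H.center v * H.center u := by
  rw [H.mul_center, h]

/-- `x, v, w, y` a `3`-arc: the centers of its ends do not commute. -/
theorem center_mul_center_ne {x v w y : V} (hxv : X.Adj x v) (hvw : X.Adj v w)
    (hwy : X.Adj w y) (h1 : x ≠ w) (h2 : v ≠ y) :
    H.center x * H.center y ≠ H.center y * H.center x := by
  intro h
  rw [H.mul_center (H.center x)] at h
  have h3 : H.center (H.center x y) = H.center y := mul_right_cancel h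
  -- `center x` fixes w and moves y, so y and its image are distinct neighbours of w and have
  -- different centers.
  refine H.center_ne_of_adj_adj (w := w) ?_ hwy ?_ h3
  · have := aut_adj (H.center x) hwy
    rw [H.center_adj_adj hxv hvw] at this
    exact this.symm
  · exact H.center_move hxv hvw hwy h1 h2

/-- An involution fixing two adjacent vertices fixes all neighbours of one of them. -/
theorem fixesStar_or_of_involution {g : X ≃g X} (hg : g * g = 1) {v w : V} (h : X.Adj v w)
    (hv : g v = v) (hw : g w = w) : FixesStar g v ∨ FixesStar g w := by
  by_contra hcon
  push Not at hcon
  obtain ⟨hnv, hnw⟩ := hcon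
  obtain ⟨x, hx, hxw⟩ := H.exists_ne h
  obtain ⟨y, hy, hyv⟩ := H.exists_ne h.symm
  have gx : g x ≠ x := fun hh => hnv (H.fixesStar h hx hxw.symm hv hw hh)
  have gy : g y ≠ y := fun hh => hnw (H.fixesStar h.symm hy hyv.symm hw hv hh)
  have sv : FixesStar (H.center y * g) v := H.fixesStar_mul h hx
    (H.center_adj_adj hy.symm h.symm) hv (H.center_adj hy.symm) hw
    (H.center_move hy.symm h.symm hx hyv hxw.symm) gx
  have sw : FixesStar (H.center x * g) w := H.fixesStar_mul h.symm hy
    (H.center_adj_adj hx.symm h) hw (H.center_adj hx.symm) hv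
    (H.center_move hx.symm h hy hxw hyv.symm) gy
  have sv' : FixesStar (H.center x * (H.center y * g)) v := (H.center_fixesStar hx.symm).mul sv
  have sw' : FixesStar (H.center x * (H.center y * g)) w := by
    refine H.fixesStar h.symm hy hyv.symm ?_ (sv'.1) ?_
    · rw [aut_mul_apply, aut_mul_apply, hw, H.center_adj hy.symm, H.center_adj_adj hx.symm h]
    · have h1 : X.Adj w (g y) := by have := aut_adj g hy; rwa [hw] at this
      rw [aut_mul_apply, aut_mul_apply, H.center_adj_adj hy.symm h1]
      exact sw.2 y hy
  have hcx : ∀ u, u = v ∨ u = w → H.center x u = u := by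
    rintro u (rfl | rfl)
    exacts [H.center_adj hx.symm, H.center_adj_adj hx.symm h]
  have hcy : ∀ u, u = v ∨ u = w → H.center y u = u := by
    rintro u (rfl | rfl)
    exacts [H.center_adj_adj hy.symm h.symm, H.center_adj hy.symm]
  have hvw : H.center v * H.center w = H.center w * H.center v := H.center_comm (H.center_adj h)
  have hx1 := H.center_comm (hcx v (Or.inl rfl))
  have hx2 := H.center_comm (hcx w (Or.inr rfl))
  have hy1 := H.center_comm (hcy v (Or.inl rfl))
  have hy2 := H.center_comm (hcy w (Or.inr rfl))
  -- `A` fixes both stars, so it lies in the Klein four-group of `center v` and `center w` and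
  -- commutes with `center x` and `center y`. Then g² = 1 forces (z_y z_x)² = 1, but centers at the
  -- ends of a 3-arc do not commute.
  set A := H.center x * (H.center y * g) with hA
  have hAcomm : Commute A (H.center x) ∧ Commute A (H.center y) ∧ A * A = 1 := by
    have c1 : Commute (H.center v) (H.center x) := hx1.symm
    have c2 : Commute (H.center w) (H.center x) := hx2.symm
    have c3 : Commute (H.center v) (H.center y) := hy1.symm
    have c4 : Commute (H.center w) (H.center y) := hy2.symm
    have c5 : Commute (H.center v) (H.center w) := hvw
    rcases H.eq_of_fixesStar_of_fixesStar h sv' sw' with h1 | h1 | h1 | h1 <;> rw [h1]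
    · exact ⟨Commute.one_left _, Commute.one_left _, one_mul 1⟩
    · exact ⟨c1, c3, H.center_mul_self v⟩
    · exact ⟨c2, c4, H.center_mul_self w⟩
    · refine ⟨c1.mul_left c2, c3.mul_left c4, ?_⟩
      rw [c5.symm.mul_mul_mul_comm, H.center_mul_self, H.center_mul_self, one_mul]
  obtain ⟨cx, cy, cA⟩ := hAcomm
  have hgA : g = H.center y * H.center x * A := by
    rw [hA, mul_assoc, H.center_mul_cancel_left, H.center_mul_cancel_left]
  have hyx : H.center y * H.center x * (H.center y * H.center x) = 1 := by
    have hc : Commute A (H.center y * H.center x) := cy.mul_right cx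
    rw [hgA, hc.mul_mul_mul_comm, cA, mul_one] at hg
    exact hg
  refine H.center_mul_center_ne hx.symm h hy hxw hyv.symm ?_
  have := eq_inv_of_mul_eq_one_left hyx
  rw [mul_inv_rev, H.center_inv, H.center_inv] at this
  exact this.symm

end FiveArcRegular

/-! ### Fixed vertices and sign of an involution outside K. -/

namespace FiveArcRegular

variable (H : FiveArcRegular X)
include H

theorem eq_center_of_fixesStar_of_notMem {K : Subgroup (X ≃g X)}
    (hK : ∀ u v, H.center u * H.center v ∈ K) {t : X ≃g X} (ht : t ∉ K) {v : V}
    (hv : FixesStar t v) : t = H.center v ∨ ∃ x, X.Adj v x ∧ t = H.center x := by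
  rcases H.eq_of_fixesStar hv with h | h | ⟨x, hx, h | h⟩
  · exact absurd (h ▸ K.one_mem) ht
  · exact Or.inl h
  · exact Or.inr ⟨x, hx, h⟩
  · exact absurd (h ▸ hK v x) ht

/-- An involution acting on three points fixes one of them. -/
theorem exists_fixed_neighbor {t : X ≃g X} (ht : t * t = 1) {v : V} (hv : t v = v) :
    ∃ w, X.Adj v w ∧ t w = w := by
  have htt : ∀ u, t (t u) = u := fun u => by rw [← aut_mul_apply, ht]; rfl
  obtain ⟨x, hx⟩ := H.exists_adj v
  obtain ⟨y, w, hy, hw, hyx, hwx, hyw⟩ := H.exists_other v x hx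
  have hadj : ∀ u, X.Adj v u → X.Adj v (t u) := fun u hu => by
    have := aut_adj t hu; rwa [hv] at this
  have hc := fun u hu => H.eq_of_adj (d := t u) hx hy hw (hadj u hu) hyx.symm hwx.symm hyw
  rcases hc x hx with h | h | h
  · exact ⟨x, hx, h⟩
  · refine ⟨w, hw, ?_⟩
    have h' : t y = x := by rw [← h, htt]
    rcases hc w hw with h1 | h1 | h1
    · exact absurd (aut_inj t (h1.trans h'.symm)) hyw.symm
    · exact absurd (aut_inj t (h1.trans h.symm)) hwx
    · exact h1
  · refine ⟨y, hy, ?_⟩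
    have h' : t w = x := by rw [← h, htt]
    rcases hc y hy with h1 | h1 | h1
    · exact absurd (aut_inj t (h1.trans h'.symm)) hyw
    · exact h1
    · exact absurd (aut_inj t (h1.trans h.symm)) hyx

/-- The fixed vertices of an involution `t` outside an index-two subgroup containing no centers
are partitioned by the balls of radius `2` around the vertices with center `t`. -/
theorem card_fixed [Fintype V] [DecidableEq V] {K : Subgroup (X ≃g X)}
    (hK : ∀ u v, H.center u * H.center v ∈ K) {t : X ≃g X} (ht : t ∉ K) (htt : t * t = 1) :
    Nat.card {v // t v = v} = 10 * Nat.card {u // H.center u = t} := by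
  classical
  -- Every element of `U` accounts for one vertex of `U`, three of `M` and six of `L`: the layers of
  -- its ball of radius 2.
  set U : Finset V := {u | H.center u = t} with hU
  set M : Finset V := {v | FixesStar t v ∧ H.center v ≠ t} with hM
  set L : Finset V := {v | t v = v ∧ ¬ FixesStar t v} with hL
  have memU : ∀ u, u ∈ U ↔ H.center u = t := by simp [hU]
  have memM : ∀ u, u ∈ M ↔ FixesStar t u ∧ H.center u ≠ t := by simp [hM]
  have memL : ∀ u, u ∈ L ↔ t u = u ∧ ¬ FixesStar t u := by simp [hL]
  have starU : ∀ {u}, u ∈ U → FixesStar t u := fun {u} hu => by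
    rw [← (memU u).1 hu]; exact (H.center_fixesBall u).star
  have nbrU : ∀ {u x}, u ∈ U → X.Adj u x → x ∈ M := fun {u x} hu hx => by
    rw [memM]
    have hu' := (memU u).1 hu
    refine ⟨by rw [← hu']; exact H.center_fixesStar hx, ?_⟩
    rw [← hu']
    exact (H.center_ne_of_adj hx).symm
  have h1 : U.card * 3 = M.card * 1 := by
    refine Finset.card_mul_eq_card_mul X.Adj ?_ ?_
    · intro u hu
      obtain ⟨x, hx⟩ := H.exists_adj u
      obtain ⟨y, w, hy, hw, hyx, hwx, hyw⟩ := H.exists_other u x hx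
      refine Finset.card_eq_three.2 ⟨x, y, w, hyx.symm, hwx.symm, hyw, ?_⟩
      ext a
      simp only [Finset.mem_bipartiteAbove, Finset.mem_insert, Finset.mem_singleton]
      constructor
      · rintro ⟨-, ha⟩
        exact H.eq_of_adj hx hy hw ha hyx.symm hwx.symm hyw
      · rintro (rfl | rfl | rfl)
        exacts [⟨nbrU hu hx, hx⟩, ⟨nbrU hu hy, hy⟩, ⟨nbrU hu hw, hw⟩]
    · intro m hm
      rw [memM] at hm
      obtain ⟨u, hmu, hu⟩ := (H.eq_center_of_fixesStar_of_notMem hK ht hm.1).resolve_left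
        (Ne.symm hm.2)
      refine Finset.card_eq_one.2 ⟨u, ?_⟩
      ext a
      simp only [Finset.mem_bipartiteBelow, Finset.mem_singleton]
      constructor
      · rintro ⟨ha, ham⟩
        by_contra hne
        exact H.center_ne_of_adj_adj ham hmu hne (((memU a).1 ha).trans hu)
      · rintro rfl
        exact ⟨(memU a).2 hu.symm, hmu.symm⟩
  have h2 : M.card * 2 = L.card * 1 := by
    refine Finset.card_mul_eq_card_mul X.Adj ?_ ?_
    · intro m hm
      rw [memM] at hm
      obtain ⟨u, hmu, hu⟩ := (H.eq_center_of_fixesStar_of_notMem hK ht hm.1).resolve_left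
        (Ne.symm hm.2)
      obtain ⟨x, y, hx, hy, hxu, hyu, hxy⟩ := H.exists_other m u hmu
      have key : ∀ x, X.Adj m x → x ≠ u → x ∈ L := by
        intro x hx hxu
        rw [memL]
        refine ⟨hm.1.2 x hx, fun hst => ?_⟩
        rcases H.eq_center_of_fixesStar_of_notMem hK ht hst with h | ⟨u', hu', h⟩
        · exact H.center_ne_of_adj_adj hmu.symm hx hxu.symm (hu.symm.trans h)
        · obtain ⟨k, hk, hkm⟩ := H.exists_ne hmu.symm
          obtain ⟨k', hk', hkx⟩ := H.exists_ne hu'.symm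
          have hmu' : m ≠ u' := by rintro rfl; exact hm.2 h.symm
          have hks : t k = k := by rw [hu]; exact H.center_adj hk
          have hks' : t k' = k' := by rw [h]; exact H.center_adj hk'
          -- If t were the center of both u and u', it would fix the 5-arc k, u, m, x, u', k'.
          have := H.rigid (g := t) ⟨hk.symm, hmu.symm, hx, hu', hk', hkm, hxu.symm, hmu', hkx.symm⟩
            hks (hm.1.2 u hmu) hm.1.1 hst.1 (hst.2 u' hu') hks'
          exact ht (this ▸ K.one_mem)
      refine Finset.card_eq_two.2 ⟨x, y, hxy, ?_⟩
      ext a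
      simp only [Finset.mem_bipartiteAbove, Finset.mem_insert, Finset.mem_singleton]
      constructor
      · rintro ⟨haL, ha⟩
        refine (H.eq_of_adj hmu hx hy ha hxu.symm hyu.symm hxy).resolve_left ?_
        rintro rfl
        exact ((memL a).1 haL).2 (starU ((memU a).2 hu.symm))
      · rintro (rfl | rfl)
        exacts [⟨key _ hx hxu, hx⟩, ⟨key _ hy hyu, hy⟩]
    · intro l hl
      rw [memL] at hl
      obtain ⟨w, hw, htw⟩ := H.exists_fixed_neighbor htt hl.1
      refine Finset.card_eq_one.2 ⟨w, ?_⟩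
      ext a
      simp only [Finset.mem_bipartiteBelow, Finset.mem_singleton]
      constructor
      · rintro ⟨ha, hal⟩
        by_contra hne
        exact hl.2 (H.fixesStar hal.symm hw hne hl.1 ((memM a).1 ha).1.1 htw)
      · rintro rfl
        refine ⟨(memM a).2 ⟨(H.fixesStar_or_of_involution htt hw hl.1 htw).resolve_left hl.2, ?_⟩,
          hw.symm⟩
        rintro rfl
        exact hl.2 (H.center_fixesStar hw.symm)
  have h3 : ({v | t v = v} : Finset V) = U ∪ M ∪ L := by
    ext v
    simp only [Finset.mem_filter, Finset.mem_univ, true_and, Finset.mem_union, memU, memM, memL]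
    constructor
    · intro hv
      by_cases hs : FixesStar t v
      · by_cases hc : H.center v = t
        · exact Or.inl (Or.inl hc)
        · exact Or.inl (Or.inr ⟨hs, hc⟩)
      · exact Or.inr ⟨hv, hs⟩
    · rintro ((h | h) | h)
      · rw [← h]; exact H.center_self v
      · exact h.1.1
      · exact h.1
  have d1 : Disjoint U M := Finset.disjoint_left.2 fun v hv hv' =>
    ((memM v).1 hv').2 ((memU v).1 hv)
  have d2 : Disjoint (U ∪ M) L := Finset.disjoint_left.2 fun v hv hv' => by
    rcases Finset.mem_union.1 hv with h | h
    · exact ((memL v).1 hv').2 (starU h)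
    · exact ((memL v).1 hv').2 ((memM v).1 h).1
  rw [Nat.card_eq_fintype_card, Nat.card_eq_fintype_card, Fintype.card_of_subtype U memU,
    Fintype.card_subtype, h3, Finset.card_union_of_disjoint d2, Finset.card_union_of_disjoint d1]
  omega

end FiveArcRegular

/-- The involution is a product of n - k transpositions; n + k has the same parity and avoids
truncated subtraction. -/
theorem sign_of_mul_self_eq_one [Fintype V] [DecidableEq V] {g : X ≃g X} (hg : g * g = 1) {n k : ℕ}
    (hn : Fintype.card V = 2 * n) (hk : Nat.card {v // g v = v} = 2 * k) :
    Equiv.Perm.sign g.toEquiv = (-1) ^ (n + k) := by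
  have h2 : (g.toEquiv : Equiv.Perm V) ^ 2 = 1 := by
    ext v
    rw [pow_two]
    exact DFunLike.congr_fun hg v
  rw [Equiv.Perm.sign_of_pow_two_eq_one h2]
  have hf : Fintype.card (Function.fixedPoints (g.toEquiv : Equiv.Perm V)) = 2 * k :=
    Nat.card_eq_fintype_card.symm.trans hk
  have hle : 2 * k ≤ 2 * n := by rw [← hf, ← hn]; exact set_fintype_card_le_univ _
  have : n + k = (2 * n - 2 * k) / 2 + 2 * k := by omega
  rw [hf, hn, this, pow_add, pow_mul, neg_one_sq, one_pow, mul_one]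

/-! ### Arc and edge stabilizers as 2-groups. -/

/-- The number of points of an invariant set is congruent modulo `2` to the number of points
fixed by a `2`-group. -/
theorem card_modEq_card_fixed {G α : Type*} [Group G] [Finite α] (f : G →* Function.End α)
    (P : Subgroup G) (hP : ∀ g ∈ P, ∃ k : ℕ, g ^ 2 ^ k = 1) (A : Set α)
    (hA : ∀ g ∈ P, ∀ a ∈ A, f g a ∈ A) :
    Nat.card {a // a ∈ A} ≡ Nat.card {a // a ∈ A ∧ ∀ g ∈ P, f g a = a} [MOD 2] := by
  let : MulAction P {a // a ∈ A} :=
    { smul := fun g a => ⟨f g a, hA g g.2 a a.2⟩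
      one_smul := fun a => Subtype.ext (by
        change f ((1 : P) : G) a = a
        rw [Subgroup.coe_one, map_one]; rfl)
      mul_smul := fun g h a => Subtype.ext (by
        change f ((g * h : P) : G) a = f g (f h a)
        rw [Subgroup.coe_mul, map_mul]; rfl) }
  have hp : IsPGroup 2 P := isPGroup_iff_pow_pow_eq_one.2 fun g => by
    obtain ⟨k, hk⟩ := hP g g.2
    exact ⟨k, Subtype.ext (by simpa using hk)⟩
  have : Fact (Nat.Prime 2) := ⟨Nat.prime_two⟩
  refine (hp.card_modEq_card_fixedPoints {a // a ∈ A}).trans ?_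
  refine congrArg (· % 2) (Nat.card_congr
    { toFun := fun a => ⟨a.1.1, a.1.2, fun g hg => congrArg Subtype.val (a.2 ⟨g, hg⟩)⟩
      invFun := fun a => ⟨⟨a.1, a.2.1⟩, fun g => Subtype.ext (a.2.2 g g.2)⟩
      left_inv := fun a => rfl
      right_inv := fun a => rfl })

/-- The action of automorphisms on vertices. -/
def vertexAction (X : SimpleGraph V) : (X ≃g X) →* Function.End V where
  toFun g := (g : V → V)
  map_one' := rfl
  map_mul' _ _ := rfl

/-- The action of automorphisms on unordered pairs of vertices. -/
def pairAction (X : SimpleGraph V) : (X ≃g X) →* Function.End (Sym2 V) where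
  toFun g := Sym2.map g
  map_one' := Sym2.map_id
  map_mul' g h := Sym2.map_comp (g := g) (f := h)

/-- The stabilizer of the arc `(v, w)`. -/
def arcStab (X : SimpleGraph V) (v w : V) : Subgroup (X ≃g X) where
  carrier := {g | g v = v ∧ g w = w}
  one_mem' := ⟨rfl, rfl⟩
  mul_mem' {g h} hg hh := ⟨by rw [aut_mul_apply, hh.1, hg.1], by rw [aut_mul_apply, hh.2, hg.2]⟩
  inv_mem' {g} hg := ⟨aut_inv_apply_eq.2 hg.1.symm, aut_inv_apply_eq.2 hg.2.symm⟩

theorem mem_arcStab {v w : V} {g : X ≃g X} : g ∈ arcStab X v w ↔ g v = v ∧ g w = w := Iff.rfl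

/-- The stabilizer of the unordered pair `{v, w}`. -/
def edgeStab (X : SimpleGraph V) (v w : V) : Subgroup (X ≃g X) where
  carrier := {g | (g v = v ∧ g w = w) ∨ (g v = w ∧ g w = v)}
  one_mem' := Or.inl ⟨rfl, rfl⟩
  mul_mem' {g h} hg hh := by
    simp only [Set.mem_ofPred_eq, aut_mul_apply] at *
    rcases hg with hg | hg <;> rcases hh with hh | hh <;> simp [hg, hh]
  inv_mem' {g} hg := by
    simp only [Set.mem_ofPred_eq, aut_inv_apply_eq] at *
    rcases hg with hg | hg <;> simp [hg]

theorem mem_edgeStab {v w : V} {g : X ≃g X} :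
    g ∈ edgeStab X v w ↔ (g v = v ∧ g w = w) ∨ (g v = w ∧ g w = v) := Iff.rfl

theorem pairAction_eq_iff {v w : V} {g : X ≃g X} :
    pairAction X g s(v, w) = s(v, w) ↔ g ∈ edgeStab X v w := by
  rw [mem_edgeStab, ← Sym2.eq_iff]; rfl

theorem arcStab_le_edgeStab (v w : V) : arcStab X v w ≤ edgeStab X v w := fun _ h => Or.inl h

instance [Finite V] : Finite (X ≃g X) :=
  Finite.of_injective (fun g => (g : V → V)) DFunLike.coe_injective

/-- Conjugation embeds `Q` into `P`, so an inclusion between conjugate finite subgroups is an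
equality. -/
theorem card_le_of_conj [Finite V] {P Q : Subgroup (X ≃g X)} (k : X ≃g X)
    (h : ∀ g ∈ Q, k⁻¹ * g * k ∈ P) (hle : P ≤ Q) : P = Q := by
  refine Subgroup.eq_of_le_of_card_ge hle ?_
  refine Nat.card_le_card_of_injective (fun g : Q => (⟨k⁻¹ * g * k, h g g.2⟩ : P)) ?_
  intro g g' hgg
  exact Subtype.ext (by simpa using congrArg Subtype.val hgg)

namespace FiveArcRegular

variable (H : FiveArcRegular X)
include H

theorem arcStab_eq_of_le [Finite V] {v w x y : V} (h : X.Adj v w) (h' : X.Adj x y)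
    (hle : arcStab X v w ≤ arcStab X x y) : arcStab X v w = arcStab X x y := by
  obtain ⟨k, rfl, rfl⟩ := H.trans1 h h'
  refine card_le_of_conj k (fun g hg => ?_) hle
  rw [mem_arcStab] at hg ⊢
  simp only [aut_mul_apply, hg, aut_inv_apply_self, and_self]

theorem edgeStab_eq_of_le [Finite V] {v w x y : V} (h : X.Adj v w) (h' : X.Adj x y)
    (hle : edgeStab X v w ≤ edgeStab X x y) : edgeStab X v w = edgeStab X x y := by
  obtain ⟨k, rfl, rfl⟩ := H.trans1 h h'
  refine card_le_of_conj k (fun g hg => ?_) hle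
  rw [mem_edgeStab] at hg ⊢
  rcases hg with hg | hg <;> simp [aut_mul_apply, hg]

theorem fixesStar_mul_self {g : X ≃g X} {v w : V} (h : X.Adj v w) (hv : g v = v) (hw : g w = w) :
    FixesStar (g * g) v := by
  obtain ⟨x, hx, hxw⟩ := H.exists_ne h
  by_cases hgx : g x = x
  · have := H.fixesStar h hx hxw.symm hv hw hgx
    exact this.mul this
  · exact H.fixesStar_mul h hx hv hv hw hw hgx hgx

/-- Squares fix the stars of both v and w, hence lie in the Klein four-group of the two centers. -/
theorem arcStab_pow {v w : V} (h : X.Adj v w) {g : X ≃g X} (hg : g ∈ arcStab X v w) :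
    g ^ 4 = 1 := by
  have h1 := H.fixesStar_mul_self h hg.1 hg.2
  have h2 := H.fixesStar_mul_self h.symm hg.2 hg.1
  have h4 : g ^ 4 = (g * g) * (g * g) := by rw [← pow_two, ← pow_two, ← pow_mul]
  rw [h4]
  have hc : Commute (H.center w) (H.center v) := H.center_comm (H.center_adj h.symm)
  rcases H.eq_of_fixesStar_of_fixesStar h h1 h2 with h | h | h | h <;> rw [h]
  · exact one_mul 1
  · exact H.center_mul_self v
  · exact H.center_mul_self w
  · rw [hc.mul_mul_mul_comm, H.center_mul_self, H.center_mul_self, one_mul]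

theorem edgeStab_pow {v w : V} (h : X.Adj v w) {g : X ≃g X} (hg : g ∈ edgeStab X v w) :
    g ^ 2 ^ 3 = 1 := by
  have h1 : g * g ∈ arcStab X v w := by
    rw [mem_arcStab, aut_mul_apply, aut_mul_apply]
    rcases hg with hg | hg <;> simp [hg]
  have h2 : g ^ 2 ^ 3 = (g * g) ^ 4 := by rw [← pow_two, ← pow_mul]; norm_num
  rw [h2, H.arcStab_pow h h1]

/-- The stabilizer of the arc `(v, w)` moves every neighbour of `v` other than `w`. -/
theorem exists_arcStab_move {v w x : V} (h : X.Adj v w) (hx : X.Adj v x) (hxw : x ≠ w) :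
    ∃ g ∈ arcStab X v w, g x ≠ x := by
  obtain ⟨y, hy, hyw, hyx, -⟩ := H.exists_third h hx hxw.symm
  obtain ⟨g, h1, h2, h3⟩ := H.trans2 h.symm hx hxw.symm h.symm hy hyw.symm
  exact ⟨g, ⟨h2, h1⟩, by rw [h3]; exact hyx⟩

/-- Reverse a 5-arc with middle edge {v, w}; the square of the reversal fixes that 5-arc. -/
theorem exists_flip {v w : V} (h : X.Adj v w) :
    ∃ a : X ≃g X, a * a = 1 ∧ a v = w ∧ a w = v := by
  obtain ⟨x, hx, hxw⟩ := H.exists_ne h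
  obtain ⟨y, hy, hyv⟩ := H.exists_ne h.symm
  obtain ⟨p, q, hpq⟩ := H.exists_arc_extension hx.symm h hy hxw hyv.symm
  have hqp : Arc5 X q y w v x p := by
    obtain ⟨h1, h2, h3, h4, h5, h6, h7, h8, h9⟩ := hpq
    exact ⟨h5.symm, h4.symm, h3.symm, h2.symm, h1.symm, h9.symm, h8.symm, h7.symm, h6.symm⟩
  obtain ⟨a, h1, h2, h3, h4, h5, h6⟩ := H.trans hpq hqp
  refine ⟨a, H.rigid hpq ?_ ?_ ?_ ?_ ?_ ?_, h3, h4⟩ <;>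
    simp [aut_mul_apply, h1, h2, h3, h4, h5, h6]

/-- An involution outside `K` fixing the arc `(v, w)` is the center of `v`, of `w`, or of a
neighbour of one of them. -/
theorem eq_center_of_involution {K : Subgroup (X ≃g X)}
    (hK : ∀ u v, H.center u * H.center v ∈ K) {t : X ≃g X} (ht : t ∉ K) (htt : t * t = 1)
    {v w : V} (h : X.Adj v w) (hv : t v = v) (hw : t w = w) :
    t = H.center v ∨ t = H.center w ∨ (∃ x, X.Adj v x ∧ x ≠ w ∧ t = H.center x) ∨
      ∃ x, X.Adj w x ∧ x ≠ v ∧ t = H.center x := by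
  rcases H.fixesStar_or_of_involution htt h hv hw with hs | hs
  · rcases H.eq_center_of_fixesStar_of_notMem hK ht hs with h1 | ⟨x, hx, h1⟩
    · exact Or.inl h1
    · by_cases hxw : x = w
      · subst hxw; exact Or.inr (Or.inl h1)
      · exact Or.inr (Or.inr (Or.inl ⟨x, hx, hxw, h1⟩))
  · rcases H.eq_center_of_fixesStar_of_notMem hK ht hs with h1 | ⟨x, hx, h1⟩
    · exact Or.inr (Or.inl h1)
    · by_cases hxv : x = v
      · subst hxv; exact Or.inl h1
      · exact Or.inr (Or.inr (Or.inr ⟨x, hx, hxv, h1⟩))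

/-- A central involution of the stabilizer of `(v, w)` outside `K` is the center of `v` or `w`. -/
theorem eq_center_of_central {K : Subgroup (X ≃g X)}
    (hK : ∀ u v, H.center u * H.center v ∈ K) {t : X ≃g X} (ht : t ∉ K) (htt : t * t = 1)
    {v w : V} (h : X.Adj v w) (hv : t v = v) (hw : t w = w)
    (hc : ∀ g ∈ arcStab X v w, g * t = t * g) : t = H.center v ∨ t = H.center w := by
  -- The center of a further neighbour x is not central, since the arc stabilizer moves x to another
  -- neighbour of v, with a different center.
  have key : ∀ {v w x : V}, X.Adj v w → X.Adj v x → x ≠ w → t = H.center x →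
      (∀ g ∈ arcStab X v w, g * t = t * g) → False := by
    intro v w x h hx hxw htx hc
    obtain ⟨g, hg, hgx⟩ := H.exists_arcStab_move h hx hxw
    have h1 := hc g hg
    rw [htx, H.mul_center] at h1
    have hgv : X.Adj (g x) v := by
      have := aut_adj g hx.symm; rwa [hg.1] at this
    exact H.center_ne_of_adj_adj hgv hx hgx (mul_right_cancel h1)
  rcases H.eq_center_of_involution hK ht htt h hv hw with h1 | h1 | ⟨x, hx, hxw, h1⟩ | ⟨x, hx, hxv, h1⟩
  · exact Or.inl h1
  · exact Or.inr h1
  · exact (key h hx hxw h1 hc).elim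
  · exact (key h.symm hx hxv h1 fun g hg => hc g ⟨hg.2, hg.1⟩).elim

theorem center_ne_of_arc3 {x v w y : V} (hxv : X.Adj x v) (hvw : X.Adj v w)
    (hwy : X.Adj w y) (h1 : x ≠ w) (h2 : v ≠ y) : H.center x ≠ H.center y := fun h =>
  H.center_mul_center_ne hxv hvw hwy h1 h2 (by rw [h])

/-- If the stabilizer of the edge `{v, w}` stabilizes the edge `{x, y}`, then the stabilizer of
the arc `(v, w)` fixes `x` and `y`. -/
theorem arcStab_le_of_edgeStab_le [Finite V] {K : Subgroup (X ≃g X)}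
    (hK : ∀ u v, H.center u * H.center v ∈ K) (hK' : ∀ u, H.center u ∉ K) {v w x y : V}
    (h : X.Adj v w) (h' : X.Adj x y) (hle : edgeStab X v w ≤ edgeStab X x y) :
    arcStab X v w ≤ arcStab X x y := by
  have hxy : H.center x ≠ H.center y := H.center_ne_of_adj h'
  have hcent : ∀ g ∈ edgeStab X v w, g * H.center x = H.center x * g → g x = x := by
    intro g hg hgx
    rcases hle hg with h1 | h1
    · exact h1.1
    · rw [H.mul_center, h1.1] at hgx
      exact absurd (mul_right_cancel hgx).symm hxy
  have hfix : ∀ g, g x = x → g * H.center x = H.center x * g := fun g hg => by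
    rw [H.mul_center, hg]
  have hconj : ∀ u, H.center x = H.center u → ∀ g ∈ edgeStab X v w,
      H.center (g u) = H.center x ∨ H.center (g u) = H.center y := by
    intro u hu g hg
    rw [← H.conj_center, ← hu, H.conj_center]
    rcases hle hg with h1 | h1
    · rw [h1.1]; exact Or.inl rfl
    · rw [h1.1]; exact Or.inr rfl
  have hx : H.center x ∈ edgeStab X v w := by
    rw [H.edgeStab_eq_of_le h h' hle]
    exact Or.inl ⟨H.center_self x, H.center_adj h'⟩
  have hfin : (∀ g ∈ arcStab X v w, g * H.center x = H.center x * g) →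
      arcStab X v w ≤ arcStab X x y := by
    intro hc g hg
    have hg' := arcStab_le_edgeStab v w hg
    have h1 := hcent g hg' (hc g hg)
    rcases hle hg' with h2 | h2
    · exact h2
    · exact absurd (h1.symm.trans h2.1) h'.ne
  -- Conjugates of `center x` under the edge stabilizer are only `center x` and `center y`. A
  -- further neighbour u would give three: the centers of u, of `g u` beside it, and of `a u` across
  -- the edge.
  have three : ∀ {v w u : V}, X.Adj v w → X.Adj v u → u ≠ w → H.center x = H.center u →
      (∀ g ∈ edgeStab X v w, H.center (g u) = H.center x ∨ H.center (g u) = H.center y) →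
      False := by
    intro v w u h hu huw hxu hconj
    obtain ⟨g, hg, hgu⟩ := H.exists_arcStab_move h hu huw
    obtain ⟨a, -, hav, haw⟩ := H.exists_flip h
    have hgv : X.Adj (g u) v := by
      have := aut_adj g hu.symm; rwa [hg.1] at this
    have hgw : g u ≠ w := fun hh => huw (aut_inj g (hh.trans hg.2.symm))
    have hau : X.Adj w (a u) := by
      have := aut_adj a hu; rwa [hav] at this
    have hauv : v ≠ a u := fun hh => huw (aut_inj a (hh.symm.trans haw.symm))
    have h1 : H.center (g u) = H.center y :=
      (hconj g (Or.inl hg)).resolve_left fun hh =>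
        H.center_ne_of_adj_adj hgv hu hgu (hh.trans hxu)
    have h2 : H.center (a u) = H.center y :=
      (hconj a (Or.inr ⟨hav, haw⟩)).resolve_left fun hh =>
        H.center_ne_of_arc3 hu.symm h hau huw hauv (hxu.symm.trans hh.symm)
    exact H.center_ne_of_arc3 hgv h hau hgw hauv (h1.trans h2.symm)
  rcases hx with hx | hx
  · rcases H.eq_center_of_involution hK (hK' x) (H.center_mul_self x) h hx.1 hx.2 with
      h1 | h1 | ⟨u, hu, huw, h1⟩ | ⟨u, hu, huv, h1⟩
    · refine hfin fun g hg => ?_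
      rw [h1, H.mul_center, hg.1]
    · refine hfin fun g hg => ?_
      rw [h1, H.mul_center, hg.2]
    · exact (three h hu huw h1 (hconj u h1)).elim
    · refine (three h.symm hu huv h1 fun g hg => hconj u h1 g ?_).elim
      rcases hg with hg | hg
      exacts [Or.inl ⟨hg.2, hg.1⟩, Or.inr ⟨hg.2, hg.1⟩]
  -- Here t = `center x` interchanges v and w. Neither `center v` nor `center u` commutes with t, so
  -- both swap x and y, and their product commutes with t. Conjugating by t gives z_{tu} z_w = z_u
  -- z_v; applied to u, this says that z_{tu} fixes u, which lies at the other end of a 3-arc.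
  · exfalso
    set t := H.center x with ht
    obtain ⟨u, hu, huw⟩ := H.exists_ne h
    have htu : X.Adj w (t u) := by have := aut_adj t hu; rwa [hx.1] at this
    have htuv : v ≠ t u := fun hh => huw (aut_inj t (hh.symm.trans hx.2.symm))
    have hne := H.center_ne_of_arc3 hu.symm h htu huw htuv
    have hzv : H.center v ∈ edgeStab X v w := Or.inl ⟨H.center_self v, H.center_adj h⟩
    have hzu : H.center u ∈ edgeStab X v w :=
      Or.inl ⟨H.center_adj hu.symm, H.center_adj_adj hu.symm h⟩
    have comm : ∀ z : X ≃g X, z x = x → t * z = z * t := fun z hz => (hfix z hz).symm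
    have nv : ¬ H.center v x = x := fun hh => by
      have h1 := comm _ hh
      rw [H.mul_center, hx.1] at h1
      exact H.center_ne_of_adj h (mul_right_cancel h1).symm
    have nu : ¬ H.center u x = x := fun hh => by
      have h1 := comm _ hh
      rw [H.mul_center] at h1
      exact hne (mul_right_cancel h1).symm
    have ev := (hle hzv).resolve_left fun hh => nv hh.1
    have eu := (hle hzu).resolve_left fun hh => nu hh.1
    have h1 := comm (H.center u * H.center v) (by rw [aut_mul_apply, ev.1, eu.2])
    rw [← mul_assoc, H.mul_center t, mul_assoc, H.mul_center t, hx.1, ← mul_assoc] at h1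
    have h2 := congrArg (fun k : X ≃g X => k u) (mul_right_cancel h1)
    simp only [aut_mul_apply, H.center_adj hu, H.center_self,
      H.center_adj_adj h.symm hu] at h2
    exact H.center_move htu.symm h.symm hu htuv.symm huw.symm h2

end FiveArcRegular

/-! ### The parity of the number of vertices with a given center. -/

theorem conj_mem_arcStab {v w : V} {g s : X ≃g X} (hg : g ∈ edgeStab X v w)
    (hs : s ∈ arcStab X v w) : g⁻¹ * s * g ∈ arcStab X v w := by
  rw [mem_arcStab] at *
  rw [mem_edgeStab] at hg
  rcases hg with hg | hg <;> simp [aut_mul_apply, aut_inv_apply_eq, hg, hs]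

namespace FiveArcRegular

variable (H : FiveArcRegular X)
include H

theorem card_neighbor (v : V) : Nat.card {x // x ∈ X.neighborSet v} = 3 := by
  classical
  obtain ⟨a, ha⟩ := H.exists_adj v
  obtain ⟨b, c, hb, hc, hba, hca, hbc⟩ := H.exists_other v a ha
  have : X.neighborSet v = (({a, b, c} : Finset V) : Set V) := by
    ext d
    simp only [SimpleGraph.mem_neighborSet, Finset.coe_insert, Finset.coe_singleton,
      Set.mem_insert_iff, Set.mem_singleton_iff]
    constructor
    · intro hd
      exact H.eq_of_adj ha hb hc hd hba.symm hca.symm hbc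
    · rintro (rfl | rfl | rfl) <;> assumption
  rw [this]
  have h3 : ({a, b, c} : Finset V).card = 3 := by
    rw [Finset.card_eq_three]
    exact ⟨a, b, c, hba.symm, hca.symm, hbc, rfl⟩
  rw [← h3]
  exact Nat.card_eq_card_toFinset _ |>.trans (by simp)

/-- A vertex fixed by the stabilizer of an arc has a unique neighbour with this property. -/
theorem exists_mate [Finite V] {v w u : V} (h : X.Adj v w)
    (hu : ∀ g ∈ arcStab X v w, g u = u) :
    ∃ m, X.Adj u m ∧ (∀ g ∈ arcStab X v w, g m = m) ∧
      ∀ m', X.Adj u m' → (∀ g ∈ arcStab X v w, g m' = m') → m' = m := by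
  -- A 2-group acting on three neighbours fixes one. If it fixes m, it equals the stabilizer of the
  -- arc (u, m), which moves the other two.
  have h1 := card_modEq_card_fixed (vertexAction X) (arcStab X v w)
    (fun g hg => ⟨2, H.arcStab_pow h hg⟩) (X.neighborSet u)
    (fun g hg a ha => by
      have := aut_adj g ha
      rwa [hu g hg] at this)
  rw [H.card_neighbor] at h1
  have h2 : Nat.card {a // a ∈ X.neighborSet u ∧ ∀ g ∈ arcStab X v w, vertexAction X g a = a} ≠ 0 :=
    fun h0 => by rw [h0] at h1; exact absurd h1 (by decide)
  obtain ⟨⟨⟨m, hm, hfix⟩⟩, -⟩ := Nat.card_ne_zero.1 h2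
  refine ⟨m, hm, hfix, fun m' hm' hfix' => ?_⟩
  by_contra hne
  have heq := H.arcStab_eq_of_le h hm fun g hg => ⟨hu g hg, hfix g hg⟩
  obtain ⟨g, hg, hgm⟩ := H.exists_arcStab_move hm hm' hne
  rw [← heq] at hg
  exact hgm (hfix' g hg)

/-- The two arc stabilizers coincide, and `center x` is a central involution of the stabilizer of
(x, y). -/
theorem center_of_arcStab_le [Finite V] {K : Subgroup (X ≃g X)}
    (hK : ∀ u v, H.center u * H.center v ∈ K) (hK' : ∀ u, H.center u ∉ K) {v w x y : V}
    (h : X.Adj v w) (h' : X.Adj x y) (hx : ∀ g ∈ arcStab X v w, g x = x)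
    (hy : ∀ g ∈ arcStab X v w, g y = y) :
    H.center x = H.center v ∨ H.center x = H.center w := by
  have heq := H.arcStab_eq_of_le h h' fun g hg => ⟨hx g hg, hy g hg⟩
  have hmem : H.center x ∈ arcStab X v w := by
    rw [heq]; exact ⟨H.center_self x, H.center_adj h'⟩
  exact H.eq_center_of_central hK (hK' x) (H.center_mul_self x) h hmem.1 hmem.2
    fun g hg => by rw [H.mul_center, hx g hg]

/-- Let S and D be the stabilizers of the arc (v, w) and of its edge. Modulo 2, the left side counts
the S-fixed vertices with center z_v. These correspond to the edges with both ends fixed by S.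
Modulo 2 those reduce to the D-fixed edges, which also count all edges. -/
theorem card_center_modEq [Finite V] {K : Subgroup (X ≃g X)}
    (hK : ∀ u v, H.center u * H.center v ∈ K) (hK' : ∀ u, H.center u ∉ K) {v w : V}
    (h : X.Adj v w) :
    Nat.card {u // H.center u = H.center v} ≡ Nat.card {e // e ∈ X.edgeSet} [MOD 2] := by
  have hpowS : ∀ g ∈ arcStab X v w, ∃ k : ℕ, g ^ 2 ^ k = 1 := fun g hg => ⟨2, H.arcStab_pow h hg⟩
  have hpowD : ∀ g ∈ edgeStab X v w, ∃ k : ℕ, g ^ 2 ^ k = 1 :=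
    fun g hg => ⟨3, H.edgeStab_pow h hg⟩
  have h1 := card_modEq_card_fixed (pairAction X) (edgeStab X v w) hpowD X.edgeSet (by
    rintro g - ⟨x, y⟩ he
    exact aut_adj g he)
  have h2 := card_modEq_card_fixed (vertexAction X) (arcStab X v w) hpowS
    {u | H.center u = H.center v} (by
      intro g hg u hu
      change H.center (g u) = H.center v
      rw [← H.conj_center, show H.center u = H.center v from hu, H.conj_center, hg.1])
  have h3 := card_modEq_card_fixed (pairAction X) (edgeStab X v w) hpowD
    {e | e ∈ X.edgeSet ∧ ∀ x ∈ e, ∀ g ∈ arcStab X v w, g x = x} (by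
      rintro g hg ⟨x, y⟩ ⟨he, hfix⟩
      refine ⟨aut_adj g he, ?_⟩
      have key : ∀ z ∈ s(x, y), ∀ s ∈ arcStab X v w, s (g z) = g z := fun z hz s hs => by
        have := hfix z hz _ (conj_mem_arcStab hg hs)
        rwa [aut_mul_apply, aut_mul_apply, aut_inv_apply_eq] at this
      intro z hz
      rcases Sym2.mem_iff.1 (show z ∈ s(g x, g y) from hz) with rfl | rfl
      exacts [key x (Sym2.mem_mk_left x y), key y (Sym2.mem_mk_right x y)])
  -- A D-fixed edge automatically has both ends fixed by S.
  have h4 : Nat.card {e // e ∈ {e | e ∈ X.edgeSet ∧ ∀ x ∈ e, ∀ g ∈ arcStab X v w, g x = x} ∧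
      ∀ g ∈ edgeStab X v w, pairAction X g e = e} =
      Nat.card {e // e ∈ X.edgeSet ∧ ∀ g ∈ edgeStab X v w, pairAction X g e = e} := by
    refine Nat.card_congr (Equiv.subtypeEquivRight ?_)
    rintro ⟨x, y⟩
    refine ⟨fun he => ⟨he.1.1, he.2⟩, fun he => ⟨⟨he.1, ?_⟩, he.2⟩⟩
    have hle := H.arcStab_le_of_edgeStab_le hK hK' h he.1
      fun g hg => pairAction_eq_iff.1 (he.2 g hg)
    intro z hz g hg
    rcases Sym2.mem_iff.1 hz with rfl | rfl
    exacts [(hle hg).1, (hle hg).2]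
  -- Join each u to its unique S-fixed neighbour. Conversely, an edge with S-fixed ends has one end
  -- with center z_v and the other with center z_w.
  have h5 : Nat.card {u // u ∈ {u | H.center u = H.center v} ∧
      ∀ g ∈ arcStab X v w, vertexAction X g u = u} =
      Nat.card {e // e ∈ {e | e ∈ X.edgeSet ∧ ∀ x ∈ e, ∀ g ∈ arcStab X v w, g x = x}} := by
    have hm : ∀ u : {u // u ∈ {u | H.center u = H.center v} ∧
        ∀ g ∈ arcStab X v w, vertexAction X g u = u}, _ := fun u => H.exists_mate h u.2.2
    choose m hm1 hm2 hm3 using hm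
    have hmne : ∀ u, H.center (m u) ≠ H.center v := fun u => by
      rw [← show H.center u = H.center v from u.2.1]
      exact (H.center_ne_of_adj (hm1 u)).symm
    refine Nat.card_congr (Equiv.ofBijective (fun u => ⟨s(u.1, m u), hm1 u, ?_⟩) ⟨?_, ?_⟩)
    · intro x hx
      rcases Sym2.mem_iff.1 hx with rfl | rfl
      exacts [u.2.2, hm2 u]
    · intro u u' huu
      have := congrArg Subtype.val huu
      rcases Sym2.eq_iff.1 this with h1 | h1
      · exact Subtype.ext h1.1
      · exact absurd (h1.1 ▸ u.2.1) (hmne u')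
    · have key : ∀ x y, X.Adj x y → (∀ g ∈ arcStab X v w, g x = x) →
          (∀ g ∈ arcStab X v w, g y = y) → ∀ hx : H.center x = H.center v,
          ∀ hf, s(x, m ⟨x, hx, hf⟩) = s(x, y) := by
        intro x y hxy hx hy hxv hf
        rw [← hm3 ⟨x, hxv, hf⟩ y hxy hy]
      rintro ⟨⟨x, y⟩, he, hfix⟩
      have hx := hfix x (Sym2.mem_mk_left x y)
      have hy := hfix y (Sym2.mem_mk_right x y)
      have hxy : X.Adj x y := he
      rcases H.center_of_arcStab_le hK hK' h hxy hx hy with h1 | h1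
      · exact ⟨⟨x, h1, hx⟩, Subtype.ext (key x y hxy hx hy h1 hx)⟩
      · have h2 := (H.center_of_arcStab_le hK hK' h hxy.symm hy hx).resolve_right
          fun hh => H.center_ne_of_adj hxy (h1.trans hh.symm)
        exact ⟨⟨y, h2, hy⟩, Subtype.ext ((key y x hxy.symm hy hx h2 hy).trans Sym2.eq_swap)⟩
  have h6 := h2.trans (Nat.ModEq.trans (congrArg (· % 2) h5) h3)
  exact h6.trans (Nat.ModEq.trans (congrArg (· % 2) h4) h1.symm)

/-- If some index-two subgroup contains no center, then every center is an even permutation. -/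
theorem sign_center [Fintype V] [DecidableEq V] {K : Subgroup (X ≃g X)}
    (hK : ∀ u v, H.center u * H.center v ∈ K) (hK' : ∀ u, H.center u ∉ K) {n : ℕ}
    (hn : Fintype.card V = 2 * n) (hE : Nat.card {e // e ∈ X.edgeSet} = 3 * n) (v : V) :
    Equiv.Perm.sign (H.center v).toEquiv = 1 := by
  obtain ⟨w, hw⟩ := H.exists_adj v
  have h1 : Nat.card {u // H.center u = H.center v} % 2 = _ % 2 := H.card_center_modEq hK hK' hw
  have h2 := H.card_fixed hK (hK' v) (H.center_mul_self v)
  set m := Nat.card {u // H.center u = H.center v}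
  rw [hE] at h1
  rw [sign_of_mul_self_eq_one (H.center_mul_self v) hn (k := 5 * m) (by rw [h2]; ring)]
  exact Even.neg_one_pow (by rw [Nat.even_iff]; omega)

end FiveArcRegular

/-! ### Characters with values ±1 and the bipartition. -/

/-- The sign of an automorphism as a permutation of the vertices. -/
def signHom (X : SimpleGraph V) [Fintype V] [DecidableEq V] : (X ≃g X) →* ℤˣ where
  toFun g := Equiv.Perm.sign (g.toEquiv : Equiv.Perm V)
  map_one' := Equiv.Perm.sign_one
  map_mul' g h := Equiv.Perm.sign_mul (g.toEquiv : Equiv.Perm V) h.toEquiv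

namespace FiveArcRegular

variable (H : FiveArcRegular X)
include H

/-- A homomorphism to `±1` that kills all centers kills all vertex stabilizers. -/
theorem map_eq_one_of_fix (σ : (X ≃g X) →* ℤˣ) (hσ : ∀ v, σ (H.center v) = 1) {g : X ≃g X} {v : V}
    (hg : g v = v) : σ g = 1 := by
  have hstar : ∀ g : X ≃g X, FixesStar g v → σ g = 1 := by
    intro g hg
    rcases H.eq_of_fixesStar hg with h | h | ⟨x, -, h | h⟩ <;> simp [h, hσ]
  have hedge : ∀ g : X ≃g X, g v = v → ∀ w, X.Adj v w → g w = w → σ g = 1 := by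
    intro g hg w hw hgw
    obtain ⟨x, hx, hxw⟩ := H.exists_ne hw
    obtain ⟨y, hy, hyv⟩ := H.exists_ne hw.symm
    by_cases hgx : g x = x
    · exact hstar g (H.fixesStar hw hx hxw.symm hg hgw hgx)
    -- `center y` swaps the same two neighbours of v as g, so the product fixes the star of v.
    · have := hstar _ (H.fixesStar_mul hw hx hg (H.center_adj_adj hy.symm hw.symm) hgw
        (H.center_adj hy.symm) hgx (H.center_move hy.symm hw.symm hx hyv hxw.symm))
      rwa [map_mul, hσ, mul_one] at this
  obtain ⟨a, ha⟩ := H.exists_adj v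
  obtain ⟨b, c, hb, hc, hba, hca, hbc⟩ := H.exists_other v a ha
  have hadj : ∀ u, X.Adj v u → X.Adj v (g u) := fun u hu => by
    have := aut_adj g hu; rwa [hg] at this
  have hcase := fun u hu => H.eq_of_adj (d := g u) ha hb hc (hadj u hu) hba.symm hca.symm hbc
  by_cases h1 : ∃ w, X.Adj v w ∧ g w = w
  · obtain ⟨w, hw, hgw⟩ := h1
    exact hedge g hg w hw hgw
  · push Not at h1
    have n1 := h1 a ha
    have n2 := h1 b hb
    have n3 := h1 c hc
    have i1 : g a ≠ g b := fun hh => hba (aut_inj g hh).symm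
    have i2 : g a ≠ g c := fun hh => hca (aut_inj g hh).symm
    have i3 : g b ≠ g c := fun hh => hbc (aut_inj g hh)
    have ca := hcase a ha
    have cb := hcase b hb
    have cc := hcase c hc
    -- Without a fixed neighbour, g permutes the three cyclically; g³ fixes them and has the same
    -- image under `σ`.
    have h3 : g (g (g a)) = a := by grind
    have := hedge (g * (g * g)) (by simp [aut_mul_apply, hg]) a ha h3
    rw [map_mul, map_mul, Int.units_mul_self, mul_one] at this
    exact this

/-- A homomorphism to `±1` killing the vertex stabilizers is trivial, or yields the
bipartition. -/
theorem bipartite_of_map_ne_one (hconn : X.Connected) (σ : (X ≃g X) →* ℤˣ)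
    (hσ : ∀ g : X ≃g X, ∀ v, g v = v → σ g = 1) {g : X ≃g X} (hg : σ g ≠ 1) :
    X.IsBipartite ∧ ∀ k u v, X.Adj u v → k u = v → σ k = -1 := by
  have hne : Nonempty V := hconn.nonempty
  have v₀ := hne.some
  -- The value of `σ` is determined by the image of any single vertex.
  have hwell : ∀ {k l : X ≃g X} {u : V}, k u = l u → σ k = σ l := by
    intro k l u hkl
    have := hσ (l⁻¹ * k) u (by rw [aut_mul_apply, aut_inv_apply_eq, hkl])
    rw [map_mul, map_inv] at this
    exact (inv_mul_eq_one.1 this).symm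
  have hflip : ∀ k u v, X.Adj u v → k u = v → σ k = -1 := by
    by_contra hcon
    push Not at hcon
    obtain ⟨k, u, v, huv, hk, hk1⟩ := hcon
    have hk1 := (Int.units_eq_one_or (σ k)).resolve_right hk1
    -- By arc-transitivity, one edge step of value 1 makes all edge steps have value 1; following
    -- walks then makes `σ` trivial.
    have hall : ∀ l x y, X.Adj x y → l x = y → σ l = 1 := by
      intro l x y hxy hl
      obtain ⟨c, hcu, hcv⟩ := H.trans1 huv hxy
      have h1 : σ (c⁻¹ * l * c) = σ k := hwell (u := u) (by
        rw [aut_mul_apply, aut_mul_apply, aut_inv_apply_eq, hcu, hl, hk, hcv])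
      rw [map_mul, map_mul, map_inv, hk1, mul_right_comm, inv_mul_cancel, one_mul] at h1
      exact h1
    apply hg
    have hwalk : ∀ x y, X.Reachable x y → ∀ l : X ≃g X, l x = y → σ l = 1 := by
      rintro x y ⟨p⟩
      induction p with
      | nil => intro l hl; exact hσ l _ hl
      | cons hadj p ih =>
        rename_i x z y
        intro l hl
        obtain ⟨c, hcx⟩ := H.trans0 x z
        have h1 := hall c x z hadj hcx
        have h2 := ih (l * c⁻¹) (by rw [aut_mul_apply, ← hl, aut_inv_apply_eq.2 hcx.symm])
        rw [map_mul, map_inv, h1, inv_one, mul_one] at h2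
        exact h2
    exact hwalk v₀ (g v₀) (hconn.preconnected _ _) g rfl
  refine ⟨?_, hflip⟩
  -- Colour u by the value of `σ` on an automorphism taking `v₀` to u.
  choose c hc using H.trans0 v₀
  refine ⟨SimpleGraph.Coloring.mk (fun u => if σ (c u) = 1 then (0 : Fin 2) else 1) ?_⟩
  intro u v huv heq
  have h1 := hflip (c v * (c u)⁻¹) u v huv (by
    rw [aut_mul_apply, aut_inv_apply_eq.2 (hc u).symm, hc v])
  rw [map_mul, map_inv] at h1
  rcases Int.units_eq_one_or (σ (c u)) with h2 | h2 <;>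
    rcases Int.units_eq_one_or (σ (c v)) with h3 | h3 <;> simp [h2, h3] at heq h1

end FiveArcRegular

/-- Along an edge both the colour of a vertex and that of its image change, so an automorphism that
changes one colour changes all of them. -/
theorem map_ne_of_bipartite (hconn : X.Connected) (C : X.Coloring (Fin 2)) {a : X ≃g X} {v w : V}
    (h : X.Adj v w) (ha : a v = w) (u : V) : a u ≠ u := by
  have key : ∀ x y, X.Reachable x y → C (a x) ≠ C x → C (a y) ≠ C y := by
    rintro x y ⟨p⟩
    induction p with
    | nil => exact id
    | cons hadj p ih =>
      rename_i x z y
      intro hx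
      refine ih ?_
      have h1 := C.valid hadj
      have h2 := C.valid (aut_adj a hadj)
      omega
  have := key v u (hconn.preconnected _ _) (by rw [ha]; exact (C.valid h).symm)
  exact fun hh => this (by rw [hh])

theorem sign_flip [Fintype V] [DecidableEq V] (hconn : X.Connected) (hbip : X.IsBipartite) {n : ℕ}
    (hn : Fintype.card V = 2 * n) {a : X ≃g X} (haa : a * a = 1) {v w : V} (h : X.Adj v w)
    (ha : a v = w) : signHom X a = (-1) ^ n := by
  obtain ⟨C⟩ := hbip
  have h0 : Nat.card {u // a u = u} = 2 * 0 := by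
    rw [mul_zero, Nat.card_eq_zero]
    exact Or.inl ⟨fun u => map_ne_of_bipartite hconn C h ha u.1 u.2⟩
  exact sign_of_mul_self_eq_one haa hn h0

namespace FiveArcRegular

variable (H : FiveArcRegular X)
include H

theorem hasOdd_iff [Fintype V] [DecidableEq V] (hconn : X.Connected) {K : Subgroup (X ≃g X)}
    (hK : ∀ u v, H.center u * H.center v ∈ K) (hK' : ∀ u, H.center u ∉ K) {n : ℕ}
    (hn : Fintype.card V = 2 * n) (hE : Nat.card {e // e ∈ X.edgeSet} = 3 * n) :
    HasOddAutomorphism X ↔ X.IsBipartite ∧ Odd n := by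
  obtain ⟨v⟩ := hconn.nonempty
  obtain ⟨w, hw⟩ := H.exists_adj v
  obtain ⟨a, haa, hav, -⟩ := H.exists_flip hw
  constructor
  · rintro ⟨g, hg⟩
    obtain ⟨hbip, hflip⟩ := H.bipartite_of_map_ne_one hconn (signHom X)
      (fun k u hk => H.map_eq_one_of_fix _ (H.sign_center hK hK' hn hE) hk) (g := g)
      (by rw [show signHom X g = -1 from hg]; decide)
    refine ⟨hbip, ?_⟩
    have h1 := sign_flip hconn hbip hn haa hw hav
    rw [hflip a v w hw hav] at h1
    by_contra hodd
    rw [(Nat.not_odd_iff_even.1 hodd).neg_one_pow] at h1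
    exact absurd h1 (by decide)
  · rintro ⟨hbip, hodd⟩
    exact ⟨a, (sign_flip hconn hbip hn haa hw hav).trans hodd.neg_one_pow⟩

end FiveArcRegular

/-! ### 4-regular subgroups have index two. -/

theorem isSArc_four {a b c d e : V} (h1 : X.Adj a b) (h2 : X.Adj b c) (h3 : X.Adj c d)
    (h4 : X.Adj d e) (h5 : a ≠ c) (h6 : b ≠ d) (h7 : c ≠ e) : IsSArc X 4 ![a, b, c, d, e] := by
  refine ⟨fun i => ?_, fun i j hij => ?_⟩
  · fin_cases i <;> simpa
  · fin_cases i <;> fin_cases j <;> simp at hij <;> simpa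

theorem Arc5.isSArc {a b c d e f : V} (h : Arc5 X a b c d e f) :
    IsSArc X 5 ![a, b, c, d, e, f] := by
  obtain ⟨h1, h2, h3, h4, h5, h6, h7, h8, h9⟩ := h
  refine ⟨fun i => ?_, fun i j hij => ?_⟩
  · fin_cases i <;> simpa
  · fin_cases i <;> fin_cases j <;> simp at hij <;> simpa

theorem fiveArcRegular [Fintype V] [DecidableRel X.Adj] (hcubic : X.IsRegularOfDegree 3)
    (h : IsSRegular X 5 ⊤) : FiveArcRegular X := by
  classical
  have hn : ∀ v, ∃ a b c, a ≠ b ∧ a ≠ c ∧ b ≠ c ∧ ∀ d, X.Adj v d ↔ d = a ∨ d = b ∨ d = c := by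
    intro v
    obtain ⟨a, b, c, hab, hac, hbc, hs⟩ := Finset.card_eq_three.1 (hcubic v)
    refine ⟨a, b, c, hab, hac, hbc, fun d => ?_⟩
    rw [← SimpleGraph.mem_neighborFinset, hs]
    simp
  refine ⟨?_, ?_, ?_, ?_, ?_⟩
  · intro v x hx
    obtain ⟨a, b, c, hab, hac, hbc, hall⟩ := hn v
    rcases (hall x).1 hx with rfl | rfl | rfl
    · exact ⟨b, c, (hall b).2 (by simp), (hall c).2 (by simp), hab.symm, hac.symm, hbc⟩
    · exact ⟨a, c, (hall a).2 (by simp), (hall c).2 (by simp), hab, hbc.symm, hac⟩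
    · exact ⟨a, b, (hall a).2 (by simp), (hall b).2 (by simp), hac, hbc, hab⟩
  · intro v x y z t hx hy hz ht hxy hxz hyz
    obtain ⟨a, b, c, hab, hac, hbc, hall⟩ := hn v
    rw [hall] at hx hy hz ht
    grind
  · intro v
    obtain ⟨a, b, c, -, -, -, hall⟩ := hn v
    exact ⟨a, (hall a).2 (Or.inl rfl)⟩
  · intro a b c d e f a' b' c' d' e' f' h1 h2
    obtain ⟨g, -, hg⟩ := h.1 _ _ h1.isSArc h2.isSArc
    exact ⟨g, hg 0, hg 1, hg 2, hg 3, hg 4, hg 5⟩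
  · intro a b c d e f h1 g ga gb gc gd ge gf
    refine h.2 _ h1.isSArc g trivial fun i => ?_
    fin_cases i <;> assumption

namespace FiveArcRegular

variable (H : FiveArcRegular X)
include H

theorem center_fixes_sArc {u : Fin 5 → V} (hu : IsSArc X 4 u) (i : Fin 5) :
    H.center (u 2) (u i) = u i := by
  have h0 : X.Adj (u 0) (u 1) := hu.1 0
  have h1 : X.Adj (u 1) (u 2) := hu.1 1
  have h2 : X.Adj (u 2) (u 3) := hu.1 2
  have h3 : X.Adj (u 3) (u 4) := hu.1 3
  fin_cases i
  exacts [H.center_adj_adj h1.symm h0.symm, H.center_adj h1.symm, H.center_self _,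
    H.center_adj h2, H.center_adj_adj h2 h3]

theorem eq_center_of_fixes_sArc {u : Fin 5 → V} (hu : IsSArc X 4 u) {g : X ≃g X}
    (hg : ∀ i, g (u i) = u i) : g = 1 ∨ g = H.center (u 2) := by
  by_cases h1 : g = 1
  · exact Or.inl h1
  · exact Or.inr (H.eq_center_of_fix4 (hu.1 0) (hu.1 1) (hu.1 2) (hu.1 3)
      (hu.2 0 2 rfl) (hu.2 1 3 rfl) (hu.2 2 4 rfl) h1 (hg 0) (hg 1) (hg 2) (hg 3) (hg 4))

theorem exists_sArc (v : V) : ∃ u : Fin 5 → V, IsSArc X 4 u ∧ u 2 = v := by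
  obtain ⟨x, hx⟩ := H.exists_adj v
  obtain ⟨y, hy, hyx⟩ := H.exists_ne hx
  obtain ⟨x₂, hx₂, hxv⟩ := H.exists_ne hx.symm
  obtain ⟨y₂, hy₂, hyv⟩ := H.exists_ne hy.symm
  exact ⟨_, isSArc_four hx₂.symm hx.symm hy hy₂ hxv hyx.symm hyv.symm, rfl⟩

theorem center_notMem {K : Subgroup (X ≃g X)} (h : IsSRegular X 4 K) (v : V) :
    H.center v ∉ K := by
  intro hv
  obtain ⟨u, hu, rfl⟩ := H.exists_sArc v
  exact H.center_ne_one _ (h.2 u hu _ hv (H.center_fixes_sArc hu))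

/-- Some k in K agrees with g on a 4-arc with middle v, so k⁻¹ g is 1 or `center v`. Thus `center v`
represents the only other coset of K. -/
theorem mul_center_mem {K : Subgroup (X ≃g X)} (h : IsSRegular X 4 K) {g : X ≃g X} (hg : g ∉ K)
    (v : V) : g * H.center v ∈ K := by
  obtain ⟨u, hu, rfl⟩ := H.exists_sArc v
  have hgu : IsSArc X 4 (fun i => g (u i)) :=
    ⟨fun i => aut_adj g (hu.1 i), fun i j hij hh => hu.2 i j hij (aut_inj g hh)⟩
  obtain ⟨k, hk, hku⟩ := h.1 _ _ hu hgu
  rcases H.eq_center_of_fixes_sArc hu (g := k⁻¹ * g)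
    (fun i => by rw [aut_mul_apply, aut_inv_apply_eq, hku]) with h1 | h1
  · rw [inv_mul_eq_one] at h1
    exact absurd (h1 ▸ hk) hg
  · rw [inv_mul_eq_iff_eq_mul] at h1
    rw [h1, mul_assoc, H.center_mul_self, mul_one]
    exact hk

theorem mul_mem_iff {K : Subgroup (X ≃g X)} (h : IsSRegular X 4 K) (g k : X ≃g X) :
    g * k ∈ K ↔ (g ∈ K ↔ k ∈ K) := by
  by_cases hg : g ∈ K
  · rw [K.mul_mem_cancel_left hg]; simp [hg]
  · by_cases hk : k ∈ K
    · rw [K.mul_mem_cancel_right hk]; simp [hk]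
    · simp only [hg, hk, iff_true]
      obtain ⟨v⟩ : Nonempty V := by
        by_contra he
        rw [not_nonempty_iff] at he
        exact hg ((show g = 1 from RelIso.ext fun v => he.elim v) ▸ K.one_mem)
      have h1 := H.mul_center_mem h hg (k v)
      have h2 := H.mul_center_mem h hk v
      rw [H.mul_center] at h2
      have := K.mul_mem h1 h2
      rwa [mul_assoc, H.center_mul_cancel_left] at this

/-- Two index-two subgroups of an elementary abelian quotient of order `4` give a third one. -/
def thirdSubgroup {K : Subgroup (X ≃g X)} (h : IsSRegular X 4 K) (σ : (X ≃g X) →* ℤˣ) :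
    Subgroup (X ≃g X) where
  carrier := {g | g ∈ K ↔ σ g = 1}
  one_mem' := by simp
  mul_mem' {g k} hg hk := by
    simp only [Set.mem_ofPred_eq] at *
    rw [H.mul_mem_iff h, hg, hk, map_mul]
    rcases Int.units_eq_one_or (σ g) with h2 | h2 <;>
      rcases Int.units_eq_one_or (σ k) with h3 | h3 <;> simp [h2, h3]
  inv_mem' {g} hg := by
    simp only [Set.mem_ofPred_eq] at *
    rw [inv_mem_iff, hg, map_inv, inv_eq_one]

theorem mem_thirdSubgroup {K : Subgroup (X ≃g X)} (h : IsSRegular X 4 K) (σ : (X ≃g X) →* ℤˣ)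
    {g : X ≃g X} : g ∈ H.thirdSubgroup h σ ↔ (g ∈ K ↔ σ g = 1) := Iff.rfl

/-- Multiplying by the center of the middle vertex does not change the action on a 4-arc but changes
membership in the subgroup, so a representative can always be corrected. -/
theorem thirdSubgroup_isSRegular {K : Subgroup (X ≃g X)} (h : IsSRegular X 4 K)
    (σ : (X ≃g X) →* ℤˣ) (hσ : ∀ v, σ (H.center v) = 1) :
    IsSRegular X 4 (H.thirdSubgroup h σ) := by
  constructor
  · intro u w hu hw
    obtain ⟨k, hk, hkw⟩ := h.1 u w hu hw
    rcases Int.units_eq_one_or (σ k) with h2 | h2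
    · exact ⟨k, by rw [mem_thirdSubgroup]; simp [hk, h2], hkw⟩
    · refine ⟨k * H.center (u 2), ?_, fun i => ?_⟩
      · rw [mem_thirdSubgroup, H.mul_mem_iff h]
        simp [hk, h2, hσ, H.center_notMem h]
      · rw [aut_mul_apply, H.center_fixes_sArc hu, hkw]
  · intro u hu g hg hgu
    refine (H.eq_center_of_fixes_sArc hu hgu).resolve_right ?_
    rintro rfl
    exact H.center_notMem h _ (hg.2 (hσ _))

end FiveArcRegular

/-! ### Universal groups and the exchange of classes 4¹ and 4². -/

theorem IsActionQuotient.exists_generators {K : Subgroup (X ≃g X)} {Gen : Type}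
    {rels : Set (FreeGroup Gen)} {S : Set Gen} {a : Gen} (h : IsActionQuotient X K rels S a) :
    ∃ f : Gen → (X ≃g X), (∀ x, f x ∈ K) ∧ (∀ r ∈ rels, FreeGroup.lift f r = 1) ∧
      ∃ v w, X.Adj v w ∧ (∀ g, g ∈ Subgroup.closure (f '' S) ↔ g ∈ K ∧ g v = v) ∧
        f a v = w ∧ f a w = v := by
  obtain ⟨φ, -, v, w, hvw, hstab, hav, haw⟩ := h
  refine ⟨fun x => φ (PresentedGroup.of x), fun x => (φ _).2, fun r hr => ?_, v, w, hvw, ?_,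
    hav, haw⟩
  · have h1 : FreeGroup.lift (fun x => (φ (PresentedGroup.of x) : X ≃g X)) =
        (K.subtype.comp φ).comp (PresentedGroup.mk rels) := by
      ext x; simp [PresentedGroup.of]
    rw [h1, MonoidHom.comp_apply, PresentedGroup.one_of_mem hr, map_one]
  · intro g
    have himg : (fun x => (φ (PresentedGroup.of x) : X ≃g X)) '' S =
        K.subtype '' ((fun x => φ (PresentedGroup.of x)) '' S) := by
      rw [Set.image_image]; rfl
    rw [himg, ← MonoidHom.map_closure, Subgroup.mem_map]
    constructor
    · rintro ⟨k, hk, rfl⟩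
      exact ⟨k.2, (hstab k).1 hk⟩
    · rintro ⟨hg, hgv⟩
      exact ⟨⟨g, hg⟩, (hstab ⟨g, hg⟩).2 hgv, rfl⟩

/-- Surjectivity follows from connectedness: the generated group contains the stabilizer of v in K
and an element taking v to a neighbour, so it is transitive on vertices and equals K. -/
theorem isActionQuotient_of_generators {K : Subgroup (X ≃g X)} {Gen : Type}
    {rels : Set (FreeGroup Gen)} {S : Set Gen} {a : Gen} (hconn : X.Connected)
    (f : Gen → (X ≃g X)) (hf : ∀ x, f x ∈ K) (hrel : ∀ r ∈ rels, FreeGroup.lift f r = 1) {v w : V}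
    (hvw : X.Adj v w) (hstab : ∀ g, g ∈ Subgroup.closure (f '' S) ↔ g ∈ K ∧ g v = v)
    (hav : f a v = w) (haw : f a w = v)
    (htrans : ∀ x, X.Adj v x → ∃ g ∈ K, g v = v ∧ g w = x) :
    IsActionQuotient X K rels S a := by
  have hlift : ∀ r, (FreeGroup.lift (fun x => (⟨f x, hf x⟩ : K)) r : X ≃g X) =
      FreeGroup.lift f r := by
    intro r
    have : K.subtype.comp (FreeGroup.lift (fun x => (⟨f x, hf x⟩ : K))) = FreeGroup.lift f := by
      ext x; simp
    exact DFunLike.congr_fun this r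
  have hrel' : ∀ r ∈ rels, FreeGroup.lift (fun x => (⟨f x, hf x⟩ : K)) r = 1 := fun r hr =>
    Subtype.ext ((hlift r).trans (hrel r hr))
  have hof : ∀ x, PresentedGroup.toGroup hrel' (PresentedGroup.of x) = (⟨f x, hf x⟩ : K) :=
    fun x => PresentedGroup.toGroup.of hrel'
  have hrange : ∀ g ∈ Subgroup.closure (Set.range f),
      ∃ y, (PresentedGroup.toGroup hrel' y : X ≃g X) = g := by
    intro g hg
    have : Subgroup.closure (Set.range f) ≤
        (K.subtype.comp (PresentedGroup.toGroup hrel')).range := by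
      rw [Subgroup.closure_le]
      rintro _ ⟨x, rfl⟩
      exact ⟨PresentedGroup.of x, by simp [hof]⟩
    exact this hg
  refine ⟨PresentedGroup.toGroup hrel', fun g => ?_, v, w, hvw, fun g => ?_, ?_, ?_⟩
  · set C := Subgroup.closure (Set.range f) with hC
    have hCK : C ≤ K := by
      rw [hC, Subgroup.closure_le]
      rintro _ ⟨x, rfl⟩
      exact hf x
    have hstabC : ∀ g ∈ K, g v = v → g ∈ C := fun g hg hgv =>
      Subgroup.closure_mono (Set.image_subset_range f S) ((hstab g).2 ⟨hg, hgv⟩)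
    have hwalk : ∀ x y, X.Reachable x y → (∃ c ∈ C, c v = x) → ∃ c ∈ C, c v = y := by
      rintro x y ⟨p⟩
      induction p with
      | nil => exact id
      | cons hadj p ih =>
        rename_i x z y
        rintro ⟨c, hc, rfl⟩
        refine ih ?_
        have h1 : X.Adj v (c⁻¹ z) := by
          have := aut_adj c⁻¹ hadj
          rwa [aut_inv_apply_self] at this
        obtain ⟨s, hs, hsv, hsw⟩ := htrans _ h1
        refine ⟨c * s * f a, C.mul_mem (C.mul_mem hc (hstabC s hs hsv))
          (Subgroup.subset_closure ⟨a, rfl⟩), ?_⟩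
        rw [aut_mul_apply, hav, aut_mul_apply, hsw, aut_apply_inv_self]
    obtain ⟨c, hc, hcv⟩ := hwalk v ((g : X ≃g X) v) (hconn.preconnected _ _) ⟨1, C.one_mem, rfl⟩
    have h2 : c⁻¹ * g ∈ C := hstabC _ (K.mul_mem (K.inv_mem (hCK hc)) g.2)
      (by rw [aut_mul_apply, aut_inv_apply_eq, hcv])
    have h3 : (g : X ≃g X) ∈ C := by
      have := C.mul_mem hc h2
      rwa [mul_inv_cancel_left] at this
    obtain ⟨y, hy⟩ := hrange _ h3
    exact ⟨y, Subtype.ext hy⟩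
  · have himg : f '' S = K.subtype ''
        ((fun x => PresentedGroup.toGroup hrel' (PresentedGroup.of x)) '' S) := by
      rw [Set.image_image]
      exact Set.image_congr fun x _ => by simp [hof]
    have h1 := hstab g
    rw [himg, ← MonoidHom.map_closure] at h1
    rw [show (g : X ≃g X) = K.subtype g from rfl, Subgroup.mem_map_iff_mem K.subtype_injective] at h1
    rw [h1]
    exact ⟨fun h => h.2, fun h => ⟨g.2, h⟩⟩
  · rw [hof]; exact hav
  · rw [hof]; exact haw

/-- The relations shared by the universal groups of types `4¹` and `4²`. -/
structure FourRelations {G : Type*} [Group G] (f : Gen4 → G) : Prop where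
  h3 : f .h ^ 3 = 1
  p2 : f .p ^ 2 = 1
  q2 : f .q ^ 2 = 1
  r2 : f .r ^ 2 = 1
  ap : f .a * f .p = f .p * f .a
  ar : f .a * f .r = f .q * f .a
  hp : (f .h)⁻¹ * f .p * f .h = f .q
  hq : (f .h)⁻¹ * f .q * f .h = f .p * f .q
  rh : f .r * f .h * f .r = (f .h)⁻¹
  pq : f .p * f .q = f .q * f .p
  pr : f .p * f .r = f .r * f .p
  rq : f .r * f .q = f .p * f .q * f .r

/-- In the form ap = pa, ar = qa the relations involving a agree for both types; only the value of
a² distinguishes them. -/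
theorem relsFourI_iff {G : Type*} [Group G] (f : Gen4 → G) :
    (∀ x ∈ relsFourI, FreeGroup.lift f x = 1) ↔ FourRelations f ∧ f .a * f .a = 1 := by
  simp only [relsFourI, Set.mem_insert_iff, Set.mem_singleton_iff, forall_eq_or_imp, forall_eq,
    map_mul, map_pow, map_inv, FreeGroup.lift_apply_of, mul_inv_eq_one]
  constructor
  · rintro ⟨h3, a2, p2, q2, r2, ap, aq, hp, hq, rh, pq, pr, rq⟩
    rw [pow_two] at a2
    refine ⟨⟨h3, p2, q2, r2, ?_, ?_, hp, hq, rh, pq, pr, rq⟩, a2⟩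
    · calc f .a * f .p = f .a * f .p * (f .a * f .a) := by rw [a2, mul_one]
        _ = f .p * f .a := by rw [← mul_assoc, ap]
    · rw [← aq, ← mul_assoc, ← mul_assoc, a2, one_mul]
  · rintro ⟨⟨h3, p2, q2, r2, ap, ar, hp, hq, rh, pq, pr, rq⟩, a2⟩
    refine ⟨h3, by rw [pow_two, a2], p2, q2, r2, ?_, ?_, hp, hq, rh, pq, pr, rq⟩
    · rw [ap, mul_assoc, a2, mul_one]
    · rw [mul_assoc, ← ar, ← mul_assoc, a2, one_mul]

theorem relsFourII_iff {G : Type*} [Group G] (f : Gen4 → G) :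
    (∀ x ∈ relsFourII, FreeGroup.lift f x = 1) ↔ FourRelations f ∧ f .a * f .a = f .p := by
  simp only [relsFourII, Set.mem_insert_iff, Set.mem_singleton_iff, forall_eq_or_imp, forall_eq,
    map_mul, map_pow, map_inv, FreeGroup.lift_apply_of, mul_inv_eq_one]
  constructor
  · rintro ⟨h3, p2, q2, r2, a2, aq, hp, hq, rh, pq, pr, rq⟩
    rw [pow_two] at a2
    refine ⟨⟨h3, p2, q2, r2, ?_, ?_, hp, hq, rh, pq, pr, rq⟩, a2⟩
    · rw [← a2, mul_assoc]
    · rw [← aq, mul_assoc, mul_inv_cancel_left]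
  · rintro ⟨⟨h3, p2, q2, r2, ap, ar, hp, hq, rh, pq, pr, rq⟩, a2⟩
    refine ⟨h3, p2, q2, r2, by rw [pow_two, a2], ?_, hp, hq, rh, pq, pr, rq⟩
    rw [mul_assoc, ← ar, inv_mul_cancel_left]

namespace FiveArcRegular

variable (H : FiveArcRegular X)
include H

/-- On the neighbours of v, both q and r fix w and at most swap the other two, so they commute
there; rq = pqr then makes p trivial. -/
theorem fixesStar_of_commutator {p q r : X ≃g X} {v w : V} (h : X.Adj v w) (hqv : q v = v)
    (hrv : r v = v) (hqw : q w = w) (hrw : r w = w) (hrq : r * q = p * q * r) :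
    FixesStar p v := by
  have hcomm : ∀ x, X.Adj v x → r (q x) = q (r x) := by
    intro x hx
    obtain ⟨y, z, hy, hz, hyw, hzw, hyz⟩ := H.exists_other v w h
    have hc : ∀ g : X ≃g X, g v = v → ∀ u, X.Adj v u → g u = w ∨ g u = y ∨ g u = z :=
      fun g hg u hu => H.eq_of_adj h hy hz (by have := aut_adj g hu; rwa [hg] at this)
        hyw.symm hzw.symm hyz
    have hin : ∀ g : X ≃g X, g w = w → ∀ u, u ≠ w → g u ≠ w := fun g hg u hu hgu =>
      hu (aut_inj g (hgu.trans hg.symm))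
    have hi : ∀ g : X ≃g X, g y ≠ g z := fun g hg => hyz (aut_inj g hg)
    have q1 := hc q hqv y hy
    have q2 := hc q hqv z hz
    have r1 := hc r hrv y hy
    have r2 := hc r hrv z hz
    have q3 := hin q hqw y hyw
    have q4 := hin q hqw z hzw
    have r3 := hin r hrw y hyw
    have r4 := hin r hrw z hzw
    have q5 := hi q
    have r5 := hi r
    rcases H.eq_of_adj h hy hz hx hyw.symm hzw.symm hyz with rfl | rfl | rfl
    · rw [hqw, hrw, hqw]
    · grind
    · grind
  have key : ∀ x, r (q x) = q (r x) → p (q (r x)) = q (r x) := fun x hx => by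
    have := congrArg (fun k : X ≃g X => k x) hrq
    simp only [aut_mul_apply] at this
    rw [← this, hx]
  refine ⟨?_, fun x hx => ?_⟩
  · have := key v (by rw [hqv, hrv, hqv])
    rwa [hrv, hqv] at this
  · have h1 : X.Adj v ((q * r)⁻¹ x) := by
      have := aut_adj (q * r)⁻¹ hx
      rwa [aut_inv_apply_eq.2 (show v = (q * r) v by rw [aut_mul_apply, hrv, hqv])] at this
    have := key _ (hcomm _ h1)
    rwa [← aut_mul_apply q r, aut_apply_inv_self] at this

/-- As p fixes the stars of v and w, it lies in the Klein four-group of the centers. Single centers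
are outside K, and p = 1 would make all generators of the stabilizer trivial, although it contains
z_v z_w ≠ 1. -/
theorem p_eq_center_mul_center {K : Subgroup (X ≃g X)} (hK : IsSRegular X 4 K)
    {f : Gen4 → (X ≃g X)} (hf : ∀ x, f x ∈ K) (hrel : FourRelations f) {v w : V}
    (hvw : X.Adj v w)
    (hstab : ∀ g, g ∈ Subgroup.closure (f '' {.h, .p, .q, .r}) ↔ g ∈ K ∧ g v = v)
    (hav : f .a v = w) (haw : f .a w = v) : f .p = H.center v * H.center w := by
  have hfix : ∀ x ∈ ({.h, .p, .q, .r} : Set Gen4), f x v = v := fun x hx =>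
    ((hstab _).1 (Subgroup.subset_closure ⟨x, hx, rfl⟩)).2
  have qv := hfix .q (by simp)
  have rv := hfix .r (by simp)
  have har : ∀ u, f .a (f .r u) = f .q (f .a u) := fun u =>
    congrArg (fun k : X ≃g X => k u) hrel.ar
  have qw : f .q w = w := by rw [← hav, ← har, rv]
  have rw' : f .r w = w := aut_inj (f .a) (by rw [har, haw, qv])
  have sv := H.fixesStar_of_commutator hvw qv rv qw rw' hrel.rq
  have sw := H.fixesStar_of_commutator hvw.symm qw rw' qv rv hrel.rq
  rcases H.eq_of_fixesStar_of_fixesStar hvw sv sw with h | h | h | h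
  · exfalso
    have hq : f .q = 1 := by rw [← hrel.hp, h]; group
    have hr : f .r = 1 := by
      have := hrel.ar
      rw [hq, one_mul] at this
      exact mul_eq_left.1 this
    have hh : f .h = 1 := by
      have h1 := hrel.rh
      rw [hr, one_mul, mul_one] at h1
      have h2 := hrel.h3
      rw [pow_succ, pow_two] at h2
      nth_rw 1 [h1] at h2
      rwa [inv_mul_cancel, one_mul] at h2
    have himg : f '' {.h, .p, .q, .r} ⊆ {1} := by
      rintro _ ⟨x, hx, rfl⟩
      simp only [Set.mem_insert_iff, Set.mem_singleton_iff] at hx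
      rcases hx with rfl | rfl | rfl | rfl <;> assumption
    have hmem : H.center v * H.center w ∈ Subgroup.closure (f '' {.h, .p, .q, .r}) :=
      (hstab _).2 ⟨H.mul_center_mem hK (H.center_notMem hK v) w, by
        rw [aut_mul_apply, H.center_adj hvw.symm, H.center_self]⟩
    have h1 : H.center v * H.center w = 1 := by
      have := Subgroup.closure_mono himg hmem
      rwa [Subgroup.closure_singleton_one, Subgroup.mem_bot] at this
    refine H.center_ne_of_adj hvw ?_
    rw [eq_inv_of_mul_eq_one_left h1, H.center_inv]
  · exact absurd (h ▸ hf .p) (H.center_notMem hK v)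
  · exact absurd (h ▸ hf .p) (H.center_notMem hK w)
  · exact h

/-- Replacing `a` by `a * center v` exchanges the types `4¹` and `4²`. -/
theorem thirdSubgroup_isActionQuotient {K : Subgroup (X ≃g X)} (hK : IsSRegular X 4 K)
    (hconn : X.Connected) (σ : (X ≃g X) →* ℤˣ) (hσ : ∀ g : X ≃g X, ∀ v, g v = v → σ g = 1)
    (hflip : ∀ k u v, X.Adj u v → k u = v → σ k = -1)
    {f : Gen4 → (X ≃g X)} (hf : ∀ x, f x ∈ K) (hrel : FourRelations f) {v w : V}
    (hvw : X.Adj v w)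
    (hstab : ∀ g, g ∈ Subgroup.closure (f '' {.h, .p, .q, .r}) ↔ g ∈ K ∧ g v = v)
    (hav : f .a v = w) (haw : f .a w = v) (rels : Set (FreeGroup Gen4))
    (hrels : ∀ f' : Gen4 → (X ≃g X), FourRelations f' →
      f' .a * f' .a = H.center w * (f .a * f .a) * H.center v → f' .p = f .p →
      ∀ r ∈ rels, FreeGroup.lift f' r = 1) :
    IsActionQuotient X (H.thirdSubgroup hK σ) rels {.h, .p, .q, .r} .a := by
  set L := H.thirdSubgroup hK σ
  have hmemL : ∀ g, g ∈ L ↔ (g ∈ K ↔ σ g = 1) := fun g => Iff.rfl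
  -- Both subgroups have the same stabilizer of v, so h, p, q, r can be kept.
  have hL : ∀ g, g v = v → (g ∈ L ↔ g ∈ K) := fun g hg => by rw [hmemL, hσ g v hg]; simp
  have hfix : ∀ x ∈ ({.h, .p, .q, .r} : Set Gen4), f x v = v := fun x hx =>
    ((hstab _).1 (Subgroup.subset_closure ⟨x, hx, rfl⟩)).2
  have hza : H.center w * f .a = f .a * H.center v := by rw [H.mul_center, hav]
  have hcomm : ∀ x ∈ ({.h, .p, .q, .r} : Set Gen4),
      f x * H.center v = H.center v * f x := fun x hx => by rw [H.mul_center, hfix x hx]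
  obtain ⟨f', hf'a, hf'h, hf'p, hf'q, hf'r⟩ : ∃ f' : Gen4 → (X ≃g X),
      f' .a = f .a * H.center v ∧ f' .h = f .h ∧ f' .p = f .p ∧ f' .q = f .q ∧ f' .r = f .r :=
    ⟨fun | .a => f .a * H.center v | .h => f .h | .p => f .p | .q => f .q | .r => f .r,
      rfl, rfl, rfl, rfl, rfl⟩
  have himg : f' '' {.h, .p, .q, .r} = f '' {.h, .p, .q, .r} := by
    simp only [Set.image_insert_eq, Set.image_singleton, hf'h, hf'p, hf'q, hf'r]
  have hav' : f' .a v = w := by rw [hf'a, aut_mul_apply, H.center_self, hav]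
  have haw' : f' .a w = v := by rw [hf'a, aut_mul_apply, H.center_adj hvw, haw]
  refine isActionQuotient_of_generators hconn f' ?_ (hrels f' ?_ ?_ hf'p) hvw ?_ hav' haw' ?_
  · have hmem : ∀ x ∈ ({.h, .p, .q, .r} : Set Gen4), f x ∈ L := fun x hx =>
      (hL _ (hfix x hx)).2 (hf x)
    rintro (_ | _ | _ | _ | _)
    · rw [hf'h]; exact hmem _ (by simp)
    -- The new a lies outside K and has `σ`-value -1, so it belongs to `L`.
    · rw [hmemL, hflip _ v w hvw hav', hf'a, H.mul_mem_iff hK]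
      simp [hf, H.center_notMem hK]
    · rw [hf'p]; exact hmem _ (by simp)
    · rw [hf'q]; exact hmem _ (by simp)
    · rw [hf'r]; exact hmem _ (by simp)
  · constructor
    · rw [hf'h, hrel.h3]
    · rw [hf'p, hrel.p2]
    · rw [hf'q, hrel.q2]
    · rw [hf'r, hrel.r2]
    · rw [hf'a, hf'p, mul_assoc, ← hcomm .p (by simp), ← mul_assoc, hrel.ap, mul_assoc]
    · rw [hf'a, hf'r, hf'q, mul_assoc, ← hcomm .r (by simp), ← mul_assoc, hrel.ar, mul_assoc]
    · rw [hf'h, hf'p, hf'q, hrel.hp]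
    · rw [hf'h, hf'p, hf'q, hrel.hq]
    · rw [hf'h, hf'r, hrel.rh]
    · rw [hf'p, hf'q, hrel.pq]
    · rw [hf'p, hf'r, hrel.pr]
    · rw [hf'p, hf'q, hf'r, hrel.rq]
  · rw [hf'a]
    nth_rw 1 [← hza]
    simp only [mul_assoc]
  · intro g
    rw [himg, hstab]
    exact and_congr_left fun hg => (hL g hg).symm
  · intro x hx
    obtain ⟨g, hgv, hgw⟩ := H.trans1 hvw hx
    by_cases hg : g ∈ K
    · exact ⟨g, (hL g hgv).2 hg, hgv, hgw⟩
    · have h1 : (g * H.center v) v = v := by rw [aut_mul_apply, H.center_self, hgv]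
      exact ⟨_, (hL _ h1).2 (H.mul_center_mem hK hg v), h1,
        by rw [aut_mul_apply, H.center_adj hvw, hgw]⟩

/-- If some homomorphism to `±1` has the bipartition as its kernel, then class `4¹` occurs if and
only if class `4²` does. -/
theorem exists_fourI_iff_fourII (hconn : X.Connected) (σ : (X ≃g X) →* ℤˣ)
    (hσ : ∀ g : X ≃g X, ∀ v, g v = v → σ g = 1)
    (hflip : ∀ k u v, X.Adj u v → k u = v → σ k = -1) :
    (∃ K : Subgroup (X ≃g X), IsOfClass X K .fourI) ↔
      ∃ K : Subgroup (X ≃g X), IsOfClass X K .fourII := by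
  constructor
  · rintro ⟨K, hK, hquot⟩
    obtain ⟨f, hf, hrel, v, w, hvw, hstab, hav, haw⟩ := hquot.exists_generators
    rw [relsFourI_iff] at hrel
    have hp := H.p_eq_center_mul_center hK hf hrel.1 hvw hstab hav haw
    refine ⟨_, H.thirdSubgroup_isSRegular hK σ fun v => hσ _ v (H.center_self v),
      H.thirdSubgroup_isActionQuotient hK hconn σ hσ hflip hf hrel.1 hvw hstab hav haw _ ?_⟩
    intro f' hf' ha' hp'
    rw [relsFourII_iff]
    refine ⟨hf', ?_⟩
    -- With a² = 1, the new square is z_w z_v = p.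
    rw [ha', hrel.2, mul_one, hp', hp, H.center_comm (H.center_adj hvw)]
  · rintro ⟨K, hK, hquot⟩
    obtain ⟨f, hf, hrel, v, w, hvw, hstab, hav, haw⟩ := hquot.exists_generators
    rw [relsFourII_iff] at hrel
    have hp := H.p_eq_center_mul_center hK hf hrel.1 hvw hstab hav haw
    refine ⟨_, H.thirdSubgroup_isSRegular hK σ fun v => hσ _ v (H.center_self v),
      H.thirdSubgroup_isActionQuotient hK hconn σ hσ hflip hf hrel.1 hvw hstab hav haw _ ?_⟩
    intro f' hf' ha' hp'
    rw [relsFourI_iff]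
    refine ⟨hf', ?_⟩
    -- With a² = p = z_v z_w, the new square is z_w z_v z_w z_v = 1.
    rw [ha', hrel.2, hp, H.center_comm (H.center_adj hvw), H.center_mul_cancel_left,
      H.center_mul_self]

end FiveArcRegular

/-! ### The edge count and the final argument. -/

theorem card_edgeSet_of_cubic [Fintype V] [DecidableRel X.Adj] (hcubic : X.IsRegularOfDegree 3)
    {n : ℕ} (hn : Fintype.card V = 2 * n) : Nat.card {e // e ∈ X.edgeSet} = 3 * n := by
  classical
  have h1 := X.sum_degrees_eq_twice_card_edges
  rw [Finset.sum_congr rfl fun v _ => hcubic v, Finset.sum_const, Finset.card_univ, hn,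
    smul_eq_mul] at h1
  have h2 : Nat.card {e // e ∈ X.edgeSet} = X.edgeFinset.card := by
    rw [SimpleGraph.edgeFinset_card]; exact Nat.card_eq_fintype_card
  omega

theorem exists_fourI_iff_fourII_of_hasOdd [Fintype V] [DecidableEq V] [DecidableRel X.Adj]
    (hconn : X.Connected) (hcubic : X.IsRegularOfDegree 3) {n : ℕ}
    (hn : Fintype.card V = 2 * n) (h5 : IsSRegular X 5 ⊤) (hodd : HasOddAutomorphism X)
    (h4 : ∃ K : Subgroup (X ≃g X), IsSRegular X 4 K) :
    (∃ K : Subgroup (X ≃g X), IsOfClass X K .fourI) ↔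
      ∃ K : Subgroup (X ≃g X), IsOfClass X K .fourII := by
  obtain ⟨g, hg⟩ := hodd
  obtain ⟨K, hK⟩ := h4
  have H := fiveArcRegular hcubic h5
  have hσ : ∀ k : X ≃g X, ∀ u, k u = u → signHom X k = 1 := fun k u hk =>
    H.map_eq_one_of_fix _ (H.sign_center (fun u v => H.mul_center_mem hK (H.center_notMem hK u) v)
      (H.center_notMem hK) hn (card_edgeSet_of_cubic hcubic hn)) hk
  exact H.exists_fourI_iff_fourII hconn _ hσ (H.bipartite_of_map_ne_one hconn (signHom X) hσ
    (g := g) (by rw [show signHom X g = -1 from hg]; decide)).2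

end CubicSymmetric

theorem proposition4p9 {V : Type*} [Fintype V] [DecidableEq V] (X : SimpleGraph V)
    [DecidableRel X.Adj] (hconn : X.Connected) (hcubic : X.IsRegularOfDegree 3)
    (hsymm : CubicSymmetric.IsSymmetric X) (n : ℕ) (hn : Fintype.card V = 2 * n) :
    (CubicSymmetric.IsSRegular X 5 ⊤ →
      (∃ K : Subgroup (X ≃g X), CubicSymmetric.IsSRegular X 4 K) →
        (CubicSymmetric.HasOddAutomorphism X ↔ X.IsBipartite ∧ Odd n)) ∧
    (CubicSymmetric.IsOfType X 5 {CubicSymmetric.ArcClass.fourI, CubicSymmetric.ArcClass.five} →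
      ¬ CubicSymmetric.HasOddAutomorphism X) ∧
    (CubicSymmetric.IsOfType X 5 {CubicSymmetric.ArcClass.fourII, CubicSymmetric.ArcClass.five} →
      ¬ CubicSymmetric.HasOddAutomorphism X) := by
  refine ⟨fun h5 ⟨K, hK⟩ => ?_, fun hT hodd => ?_, fun hT hodd => ?_⟩
  · have H := CubicSymmetric.fiveArcRegular hcubic h5
    exact H.hasOdd_iff hconn (fun u v => H.mul_center_mem hK (H.center_notMem hK u) v)
      (H.center_notMem hK) hn (CubicSymmetric.card_edgeSet_of_cubic hcubic hn)
  · have h4 := (hT.mem_iff .fourI).1 (by simp)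
    have := (hT.mem_iff .fourII).2
      ((CubicSymmetric.exists_fourI_iff_fourII_of_hasOdd hconn hcubic hn hT.regular hodd
        (h4.imp fun K hK => hK.1)).1 h4)
    simp at this
  · have h4 := (hT.mem_iff .fourII).1 (by simp)
    have := (hT.mem_iff .fourI).2
      ((CubicSymmetric.exists_fourI_iff_fourII_of_hasOdd hconn hcubic hn hT.regular hodd
        (h4.imp fun K hK => hK.1)).2 h4)
    simp at this
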